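/- Let $d\ge 3$, let $V_1,\dots,V_{d+1}\in\mathbb{R}^d$ be affinely independent points, let $S_d$ be their convex hull, and let $\lambda_1,\dots,\lambda_{d+1}$ be the barycentric coordinates with respect to $V_1,\dots,V_{d+1}$. Let $F_4\subset S_d$ be the set consisting of - the centroids $\frac14(V_i+V_j+V_k+V_\ell)$, $i<j<k<\ell$, of the 3-faces; - the points $\frac{4+\sqrt5}{11}V_i+\frac{7-\sqrt5}{22}(V_j+V_k)$, $i\ne j,k$, $j<k$; - the points $\frac{1-\sqrt{3/7}}2V_i+\frac{1+\sqrt{3/7}}2V_j$, $i\ne j$, and the midpoints $\frac12(V_i+V_j)$, $i<j$; - the vertices $V_i$. For every ${\bf a}\in F_4$ there is exactly one real polynomial $\ell_{\bf a}$ in $d$ variables of degree at most $4$ with $\ell_{\bf a}({\bf a})=1$ and $\ell_{\bf a}({\bf b})=0$ for all ${\bf b}\in F_4\setminus\{{\bf a}\}$ (the Lagrange polynomial of ${\bf a}$), and the following hold. 1. For $i<j<k<\ell$ the Lagrange polynomial of the centroid $\frac14(V_i+V_j+V_k+V_\ell)$ is $256\,\lambda_i\lambda_j\lambda_k\lambda_\ell$,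 and it is bounded by $1$ in absolute value on $S_d$. 2. If $d\in\{3,4,5,6,7\}$, then $\sum_{\bf a}\ell_{\bf a}({\bf x})^2\le 1$ for all ${\bf x}\in S_d$, where the sum runs over all points ${\bf a}\in F_4$ other than the centroids of the 3-faces. -/

import Mathlib

/-- The affine basis of `ℝ^d` formed by `d + 1` points in general position; its coordinate functions
`(vertexBasis V hV).coord i` are the barycentric coordinates `λ_i` of the simplex. -/
noncomputable def vertexBasis {d : ℕ} (V : Fin (d + 1) → Fin d → ℝ)
    (hV : AffineIndependent ℝ V) : AffineBasis (Fin (d + 1)) ℝ (Fin d → ℝ) :=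
  ⟨V, hV, hV.affineSpan_eq_top_iff_card_eq_finrank_add_one.2 (by simp)⟩

/-- The closed simplex `S_d` with vertices `V_1, …, V_{d+1}`. -/
def solidSimplex {d : ℕ} (V : Fin (d + 1) → Fin d → ℝ) : Set (Fin d → ℝ) :=
  convexHull ℝ (Set.range V)

/-- The centroids `(V_i + V_j + V_k + V_l) / 4` of the three-dimensional faces. -/
noncomputable def threeFaceCentroids {d : ℕ} (V : Fin (d + 1) → Fin d → ℝ) :
    Finset (Fin d → ℝ) :=
  (Finset.univ.filter fun t : Fin (d + 1) × Fin (d + 1) × Fin (d + 1) × Fin (d + 1) =>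
      t.1 < t.2.1 ∧ t.2.1 < t.2.2.1 ∧ t.2.2.1 < t.2.2.2).image
    fun t => (1 / 4 : ℝ) • (V t.1 + V t.2.1 + V t.2.2.1 + V t.2.2.2)

/-- The points `(4 + √5)/11 V_i + (7 - √5)/22 (V_j + V_k)` of the two-dimensional faces. -/
noncomputable def twoFacePoints {d : ℕ} (V : Fin (d + 1) → Fin d → ℝ) :
    Finset (Fin d → ℝ) :=
  (Finset.univ.filter fun t : Fin (d + 1) × Fin (d + 1) × Fin (d + 1) =>
      t.1 ≠ t.2.1 ∧ t.1 ≠ t.2.2 ∧ t.2.1 < t.2.2).image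
    fun t => ((4 + Real.sqrt 5) / 11) • V t.1 + ((7 - Real.sqrt 5) / 22) • (V t.2.1 + V t.2.2)

/-- The points `(1 - √(3/7))/2 V_i + (1 + √(3/7))/2 V_j`, `i ≠ j`, of the edges. -/
noncomputable def edgeOuterPoints {d : ℕ} (V : Fin (d + 1) → Fin d → ℝ) :
    Finset (Fin d → ℝ) :=
  (Finset.univ.filter fun t : Fin (d + 1) × Fin (d + 1) => t.1 ≠ t.2).image
    fun t => ((1 - Real.sqrt (3 / 7)) / 2) • V t.1 + ((1 + Real.sqrt (3 / 7)) / 2) • V t.2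

/-- The midpoints `(V_i + V_j) / 2` of the edges. -/
noncomputable def edgeMidpoints {d : ℕ} (V : Fin (d + 1) → Fin d → ℝ) :
    Finset (Fin d → ℝ) :=
  (Finset.univ.filter fun t : Fin (d + 1) × Fin (d + 1) => t.1 < t.2).image
    fun t => (1 / 2 : ℝ) • (V t.1 + V t.2)

/-- The degree-four interpolation set `F_4` of the simplex with vertices `V`. -/
noncomputable def degreeFourSet {d : ℕ} (V : Fin (d + 1) → Fin d → ℝ) :
    Finset (Fin d → ℝ) :=
  threeFaceCentroids V ∪ twoFacePoints V ∪ edgeOuterPoints V ∪ edgeMidpoints V ∪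
    Finset.univ.image V

/-- `p` is a fundamental Lagrange polynomial of degree at most `n` for the node `a` of `F`:
it is `1` at `a` and `0` at every other point of `F`. -/
def IsLagrangePolynomial {d : ℕ} (n : ℕ) (F : Finset (Fin d → ℝ)) (a : Fin d → ℝ)
    (p : MvPolynomial (Fin d) ℝ) : Prop :=
  p.totalDegree ≤ n ∧ MvPolynomial.eval a p = 1 ∧
    ∀ b ∈ F, b ≠ a → MvPolynomial.eval b p = 0

/-! The Lagrange polynomials are given explicitly in barycentric coordinates (`Node.value`). That
they equal 1 at their own node and 0 at the others is a case analysis on the supports of the nodes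
(`Node.value_weight_self`, `Node.value_weight_of_ne`). Every polynomial of degree at most 4 is a
combination of quartic monomials in the barycentric coordinates, and each such monomial is matched
with a node. Evaluating these combinations at the nodes is therefore an endomorphism of a
finite-dimensional space. The explicit polynomials make it surjective, hence injective, and
uniqueness follows (`IsPolynomialFunction.eq_zero_of_apply_node`). The bound for the centroids is
the inequality of arithmetic and geometric means.

For the sum of squares, symmetry allows everything to be expressed in power sums of the barycentric
coordinates: the sum is 1 minus a form of degree eight (`sum_sq_eq_one_sub_residualForm`). This form
is nonnegative for 3 to 8 nonnegative variables, by induction on their number, because deleting the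
smallest variable does not increase it (`residualForm_powerSum_erase_le`). If `t` is the smallest
variable and the others are `z + t`, the change is a polynomial in `t` and in sums of monomials in
`z` over distinct indices. For each number of remaining variables from three to seven it is written
as a combination of mean inequalities, of terms with nonnegative coefficients, and of sums that
vanish for lack of indices.

The base case is a form in three variables (`ternaryForm_nonneg`). For fixed `x + y + z` and `xy +
yz + zx` it is a concave quadratic in `xyz`, so only the ends of the range of `xyz` matter. There
two variables coincide or one is zero, and the form can be examined directly. -/

/-! ### Sums over tuples of distinct indices -/

section DistinctSums

variable {ι : Type*}

/-- The power sum of exponent `k` of the family `x` over `s`. -/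
def powerSum (x : ι → ℝ) (s : Finset ι) (k : ℕ) : ℝ := ∑ i ∈ s, x i ^ k

variable [DecidableEq ι]

/-- The sum of `x i₁ ^ a₁ * ⋯ * x iᵣ ^ aᵣ` over all tuples of distinct indices `i₁, …, iᵣ` of `s`,
where `l = [a₁, …, aᵣ]`. -/
def distinctSum (x : ι → ℝ) : List ℕ → Finset ι → ℝ
  | [], _ => 1
  | a :: l, s => ∑ i ∈ s, x i ^ a * distinctSum x l (s.erase i)

/-- The ways to single out one entry of a list, together with the list of the other entries. -/
def pickings : List ℕ → List (ℕ × List ℕ)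
  | [] => []
  | a :: l => (a, l) :: (pickings l).map fun q => (q.1, a :: q.2)

theorem distinctSum_nonneg {x : ι → ℝ} (hx : ∀ i, 0 ≤ x i) (l : List ℕ) (s : Finset ι) :
    0 ≤ distinctSum x l s := by
  induction l generalizing s with
  | nil => simp [distinctSum]
  | cons a l ih =>
    exact Finset.sum_nonneg fun i _ => mul_nonneg (pow_nonneg (hx i) a) (ih _)

/-- A tuple of distinct indices either avoids `i` or uses it at exactly one position; `pickings`
runs over these positions. -/
theorem distinctSum_eq_erase (x : ι → ℝ) (l : List ℕ) {s : Finset ι} {i : ι} (hi : i ∈ s) :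
    distinctSum x l s = distinctSum x l (s.erase i) +
      ((pickings l).map fun q => x i ^ q.1 * distinctSum x q.2 (s.erase i)).sum := by
  induction l generalizing s with
  | nil => simp [distinctSum, pickings]
  | cons a l ih =>
    have h : ∀ k ∈ s.erase i, x k ^ a * distinctSum x l (s.erase k) =
        x k ^ a * distinctSum x l ((s.erase i).erase k) +
          ((pickings l).map fun q =>
            x i ^ q.1 * (x k ^ a * distinctSum x q.2 ((s.erase i).erase k))).sum := by
      intro k hk
      rw [ih (s := s.erase k) (Finset.mem_erase.2 ⟨(Finset.ne_of_mem_erase hk).symm, hi⟩),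
        Finset.erase_right_comm, mul_add, ← List.sum_map_mul_left]
      congr 3
      funext q
      ring
    have hswap : ∀ Q : List (ℕ × List ℕ), ∑ k ∈ s.erase i, (Q.map fun q =>
        x i ^ q.1 * (x k ^ a * distinctSum x q.2 ((s.erase i).erase k))).sum =
        (Q.map fun q => x i ^ q.1 * distinctSum x (a :: q.2) (s.erase i)).sum := by
      intro Q
      induction Q with
      | nil => simp
      | cons q Q ihQ =>
        simp only [List.map_cons, List.sum_cons, Finset.sum_add_distrib, ihQ, distinctSum,
          Finset.mul_sum]
    rw [distinctSum, ← Finset.add_sum_erase s _ hi, Finset.sum_congr rfl h,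
      Finset.sum_add_distrib, hswap]
    simp only [pickings, List.map_cons, List.sum_cons, List.map_map, Function.comp_def,
      distinctSum]
    ring

/-- The distinct sum in which the exponent `a` is added to the singled out entry of a list. -/
def mergedSum (x : ι → ℝ) (s : Finset ι) (a : ℕ) (q : ℕ × List ℕ) : ℝ :=
  distinctSum x ((a + q.1) :: q.2) s

theorem mergedSum_mk (x : ι → ℝ) (s : Finset ι) (a b : ℕ) (l : List ℕ) :
    mergedSum x s a (b, l) = distinctSum x ((a + b) :: l) s := rfl

/-- The distinct sums are polynomials in the power sums; this is the recursion that computes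
them. -/
theorem distinctSum_cons (x : ι → ℝ) (a : ℕ) (l : List ℕ) (s : Finset ι) :
    distinctSum x (a :: l) s = powerSum x s a * distinctSum x l s -
      ((pickings l).map (mergedSum x s a)).sum := by
  have hswap : ∀ Q : List (ℕ × List ℕ),
      ∑ i ∈ s, x i ^ a * (Q.map fun q => x i ^ q.1 * distinctSum x q.2 (s.erase i)).sum =
        (Q.map (mergedSum x s a)).sum := by
    intro Q
    induction Q with
    | nil => simp
    | cons q Q ihQ =>
      simp only [List.map_cons, List.sum_cons, mul_add, Finset.sum_add_distrib, ihQ, mergedSum,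
        distinctSum, pow_add, mul_assoc]
  -- The product with the power sum also counts tuples in which the first index recurs. In those the
  -- two exponents merge, and they are what is subtracted.
  rw [← hswap, powerSum, Finset.sum_mul, ← Finset.sum_sub_distrib, distinctSum]
  refine Finset.sum_congr rfl fun i hi => ?_
  rw [distinctSum_eq_erase x l hi]
  ring

theorem distinctSum_nil (x : ι → ℝ) (s : Finset ι) : distinctSum x [] s = 1 := rfl

/-- The inequality of arithmetic and geometric means for distinct sums. -/
theorem two_mul_distinctSum_le {x : ι → ℝ} (hx : ∀ i, 0 ≤ x i) (l : List (ℕ × ℕ × ℕ))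
    (hl : ∀ e ∈ l, e.1 + e.2.1 = 2 * e.2.2) (s : Finset ι) {α β γ : ℝ} (hα : 0 ≤ α) (hβ : 0 ≤ β)
    (hγ : γ ^ 2 ≤ α * β) :
    0 ≤ α * distinctSum x (l.map fun e => e.1) s + β * distinctSum x (l.map fun e => e.2.1) s -
      2 * γ * distinctSum x (l.map fun e => e.2.2) s := by
  induction l generalizing s α β γ with
  | nil =>
    simp only [List.map_nil, distinctSum]
    have h : (2 * γ) ^ 2 ≤ (α + β) ^ 2 := by nlinarith [sq_nonneg (α - β)]
    linarith [(le_abs_self _).trans (abs_le_of_sq_le_sq h (by positivity))]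
  | cons e l ih =>
    simp only [List.map_cons, distinctSum]
    rw [Finset.mul_sum, Finset.mul_sum, Finset.mul_sum, ← Finset.sum_add_distrib,
      ← Finset.sum_sub_distrib]
    refine Finset.sum_nonneg fun i _ => ?_
    have he : e.1 + e.2.1 = 2 * e.2.2 := hl e (by simp)
    -- The powers of `x i` are absorbed into the coefficients; `γ ^ 2 ≤ α * β` survives because the
    -- third exponent is the mean of the first two.
    have h := ih (fun e' he' => hl e' (by simp [he'])) (s.erase i)
      (mul_nonneg hα (pow_nonneg (hx i) e.1)) (mul_nonneg hβ (pow_nonneg (hx i) e.2.1))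
      (γ := γ * x i ^ e.2.2) (by
        have : x i ^ e.1 * x i ^ e.2.1 = (x i ^ e.2.2) ^ 2 := by
          rw [← pow_add, he, ← pow_mul, mul_comm]
        calc (γ * x i ^ e.2.2) ^ 2 = γ ^ 2 * (x i ^ e.2.2) ^ 2 := by ring
          _ ≤ α * β * (x i ^ e.2.2) ^ 2 := mul_le_mul_of_nonneg_right hγ (sq_nonneg _)
          _ = _ := by rw [← this]; ring)
    linarith

end DistinctSums

/-! ### The symmetric form of degree eight -/

noncomputable section ResidualForm

variable {ι : Type*} [DecidableEq ι]

/-- The symmetric form of degree eight, in terms of the power sums `p k` of its variables, whose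
value on barycentric coordinates is `1` minus the sum of the squares of the Lagrange polynomials of
the nodes other than the centroids; `r` stands for `√5`. -/
def residualForm (r : ℝ) (p : ℕ → ℝ) : ℝ :=
  (1) * (p 1 ^ 8) +
    (-40043/8712 - 4403/2904 * r) * (p 1 ^ 6 * p 2) +
    (-125069/1452 + 1037/1452 * r) * (p 1 ^ 4 * p 2 ^ 2) +
    (-729985/968 + 141631/2904 * r) * (p 1 ^ 2 * p 2 ^ 3) +
    (-33379/242 + 40589/726 * r) * (p 2 ^ 4) +
    (40555/726 + 4541/242 * r) * (p 1 ^ 5 * p 3) +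
    (1337819/1089 - 30064/363 * r) * (p 1 ^ 3 * p 2 * p 3) +
    (4501535/726 - 294323/726 * r) * (p 1 * p 2 ^ 2 * p 3) +
    (-343335/121 + 203957/363 * r) * (p 1 ^ 2 * p 3 ^ 2) +
    (-3501052/1089 - 17884/121 * r) * (p 2 * p 3 ^ 2) +
    (-23153/121 - 33323/363 * r) * (p 1 ^ 4 * p 4) +
    (-630877/484 + 59707/1452 * r) * (p 1 ^ 2 * p 2 * p 4) +
    (-1005644/121 + 178028/363 * r) * (p 2 ^ 2 * p 4) +
    (443975/121 - 214961/121 * r) * (p 1 * p 3 * p 4) +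
    (510557/121 + 57693/121 * r) * (p 4 ^ 2) +
    (-185177/363 + 37045/121 * r) * (p 1 ^ 3 * p 5) +
    (-2921426/363 + 301900/363 * r) * (p 1 * p 2 * p 5) +
    (192342/121 + 456530/363 * r) * (p 3 * p 5) +
    (1403854/363 - 342218/363 * r) * (p 1 ^ 2 * p 6) +
    (6653791/363 - 428161/363 * r) * (p 2 * p 6) +
    (-127188/121 + 186564/121 * r) * (p 1 * p 7) +
    (-4614128/363 - 364304/363 * r) * (p 8)

/-- The power sums of the family `z + t`, in terms of those of `z`. -/
def shiftedPowerSum (z : ι → ℝ) (s : Finset ι) (t : ℝ) (k : ℕ) : ℝ :=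
  ∑ j ∈ Finset.range (k + 1), powerSum z s j * t ^ (k - j) * (k.choose j : ℝ)

omit [DecidableEq ι] in
theorem powerSum_add_const (z : ι → ℝ) (s : Finset ι) (t : ℝ) (k : ℕ) :
    powerSum (fun i => z i + t) s k = shiftedPowerSum z s t k := by
  simp only [powerSum, shiftedPowerSum, add_pow, Finset.sum_mul]
  exact Finset.sum_comm

/-- The value of an arithmetic-geometric mean inequality
`a t ^ i M(u) + b t ^ j M(v) ≥ 2 c t ^ k M(w)` for the distinct sums `M`. -/
def amGmValue (z : ι → ℝ) (s : Finset ι) (t : ℝ)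
    (e : ℝ × ℝ × ℝ × ℕ × ℕ × ℕ × List (ℕ × ℕ × ℕ)) : ℝ :=
  e.1 * t ^ e.2.2.2.1 * distinctSum z (e.2.2.2.2.2.2.map fun q => q.1) s +
    e.2.1 * t ^ e.2.2.2.2.1 * distinctSum z (e.2.2.2.2.2.2.map fun q => q.2.1) s -
    2 * (e.2.2.1 * t ^ e.2.2.2.2.2.1) * distinctSum z (e.2.2.2.2.2.2.map fun q => q.2.2) s

/-- The powers of `t` can go into the coefficients of `two_mul_distinctSum_le`, since their
exponents obey the same mean condition as those of `z`. -/
theorem sum_amGmValue_nonneg {z : ι → ℝ} (hz : ∀ i, 0 ≤ z i) (s : Finset ι) {t : ℝ} (ht : 0 ≤ t)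
    (L : List (ℝ × ℝ × ℝ × ℕ × ℕ × ℕ × List (ℕ × ℕ × ℕ)))
    (hL : ∀ e ∈ L, (0 ≤ e.1 ∧ 0 ≤ e.2.1 ∧ e.2.2.1 ^ 2 ≤ e.1 * e.2.1) ∧
      e.2.2.2.1 + e.2.2.2.2.1 = 2 * e.2.2.2.2.2.1 ∧
      ∀ q ∈ e.2.2.2.2.2.2, q.1 + q.2.1 = 2 * q.2.2) :
    0 ≤ (L.map (amGmValue z s t)).sum := by
  refine List.sum_nonneg fun y hy => ?_
  obtain ⟨e, he, rfl⟩ := List.mem_map.1 hy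
  obtain ⟨⟨ha, hb, hc⟩, hk, hq⟩ := hL e he
  refine two_mul_distinctSum_le hz _ hq s (mul_nonneg ha (pow_nonneg ht _))
    (mul_nonneg hb (pow_nonneg ht _)) ?_
  calc (e.2.2.1 * t ^ e.2.2.2.2.2.1) ^ 2 = e.2.2.1 ^ 2 * t ^ (2 * e.2.2.2.2.2.1) := by
        rw [mul_pow, ← pow_mul, mul_comm 2]
    _ ≤ e.1 * e.2.1 * t ^ (2 * e.2.2.2.2.2.1) :=
        mul_le_mul_of_nonneg_right hc (pow_nonneg ht _)
    _ = _ := by rw [← hk, pow_add]; ring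

/-- The term `(a + b r) t ^ k M(l)` with a distinct sum `M(l)`. -/
def monomialValue (r : ℝ) (z : ι → ℝ) (s : Finset ι) (t : ℝ) (e : ℝ × ℝ × ℕ × List ℕ) : ℝ :=
  (e.1 + e.2.1 * r) * (t ^ e.2.2.1 * distinctSum z e.2.2.2 s)

theorem sum_monomialValue_nonneg {r : ℝ} {z : ι → ℝ} (hz : ∀ i, 0 ≤ z i) (s : Finset ι) {t : ℝ}
    (ht : 0 ≤ t) (L : List (ℝ × ℝ × ℕ × List ℕ)) (hL : ∀ e ∈ L, 0 ≤ e.1 + e.2.1 * r) :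
    0 ≤ (L.map (monomialValue r z s t)).sum := by
  refine List.sum_nonneg fun y hy => ?_
  obtain ⟨e, he, rfl⟩ := List.mem_map.1 hy
  exact mul_nonneg (hL e he) (mul_nonneg (pow_nonneg ht _) (distinctSum_nonneg hz _ _))

theorem distinctSum_eq_zero (z : ι → ℝ) {l : List ℕ} {s : Finset ι} (h : s.card < l.length) :
    distinctSum z l s = 0 := by
  induction l generalizing s with
  | nil => simp at h
  | cons a l ih =>
    refine Finset.sum_eq_zero fun i hi => ?_
    have hc := Finset.card_erase_of_mem hi
    have hp := Finset.card_pos.2 ⟨i, hi⟩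
    rw [ih (by simp only [List.length_cons] at h; omega), mul_zero]

/-- There are no tuples of more than `s.card` distinct indices. Expanded in power sums, this is a
relation that a certificate may use with coefficients of either sign. -/
theorem sum_monomialValue_eq_zero (r : ℝ) (z : ι → ℝ) (t : ℝ) {s : Finset ι}
    (L : List (ℝ × ℝ × ℕ × List ℕ)) (hL : ∀ e ∈ L, s.card < e.2.2.2.length) :
    (L.map (monomialValue r z s t)).sum = 0 := by
  refine List.sum_eq_zero fun y hy => ?_
  obtain ⟨e, he, rfl⟩ := List.mem_map.1 hy
  rw [monomialValue, distinctSum_eq_zero z (hL e he), mul_zero, mul_zero]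

/-- Equal entries of a list give equal terms in `distinctSum_cons`. Collecting them, here and in the
next lemmas, keeps the expansion of the long distinct sums into power sums small. -/
theorem distinctSum_one_replicate_five (z : ι → ℝ) (s : Finset ι) :
    distinctSum z [1, 1, 1, 1, 1] s = powerSum z s 1 * distinctSum z [1, 1, 1, 1] s -
      4 * distinctSum z [2, 1, 1, 1] s := by
  rw [distinctSum_cons]
  simp only [pickings, mergedSum_mk, List.map_cons, List.map_nil, List.sum_cons, List.sum_nil,
    Nat.reduceAdd]
  ring

theorem distinctSum_two_replicate_four (z : ι → ℝ) (s : Finset ι) :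
    distinctSum z [2, 1, 1, 1, 1] s = powerSum z s 2 * distinctSum z [1, 1, 1, 1] s -
      4 * distinctSum z [3, 1, 1, 1] s := by
  rw [distinctSum_cons]
  simp only [pickings, mergedSum_mk, List.map_cons, List.map_nil, List.sum_cons, List.sum_nil,
    Nat.reduceAdd]
  ring

theorem distinctSum_three_replicate_four (z : ι → ℝ) (s : Finset ι) :
    distinctSum z [3, 1, 1, 1, 1] s = powerSum z s 3 * distinctSum z [1, 1, 1, 1] s -
      4 * distinctSum z [4, 1, 1, 1] s := by
  rw [distinctSum_cons]
  simp only [pickings, mergedSum_mk, List.map_cons, List.map_nil, List.sum_cons, List.sum_nil,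
    Nat.reduceAdd]
  ring

theorem distinctSum_two_two_replicate_three (z : ι → ℝ) (s : Finset ι) :
    distinctSum z [2, 2, 1, 1, 1] s = powerSum z s 2 * distinctSum z [2, 1, 1, 1] s -
      distinctSum z [4, 1, 1, 1] s - 3 * distinctSum z [3, 2, 1, 1] s := by
  rw [distinctSum_cons]
  simp only [pickings, mergedSum_mk, List.map_cons, List.map_nil, List.sum_cons, List.sum_nil,
    Nat.reduceAdd]
  ring

theorem distinctSum_one_replicate_six (z : ι → ℝ) (s : Finset ι) :
    distinctSum z [1, 1, 1, 1, 1, 1] s = powerSum z s 1 * distinctSum z [1, 1, 1, 1, 1] s -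
      5 * distinctSum z [2, 1, 1, 1, 1] s := by
  rw [distinctSum_cons]
  simp only [pickings, mergedSum_mk, List.map_cons, List.map_nil, List.sum_cons, List.sum_nil,
    Nat.reduceAdd]
  ring

theorem distinctSum_two_replicate_five (z : ι → ℝ) (s : Finset ι) :
    distinctSum z [2, 1, 1, 1, 1, 1] s = powerSum z s 2 * distinctSum z [1, 1, 1, 1, 1] s -
      5 * distinctSum z [3, 1, 1, 1, 1] s := by
  rw [distinctSum_cons]
  simp only [pickings, mergedSum_mk, List.map_cons, List.map_nil, List.sum_cons, List.sum_nil,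
    Nat.reduceAdd]
  ring

theorem distinctSum_one_replicate_seven (z : ι → ℝ) (s : Finset ι) :
    distinctSum z [1, 1, 1, 1, 1, 1, 1] s = powerSum z s 1 * distinctSum z [1, 1, 1, 1, 1, 1] s -
      6 * distinctSum z [2, 1, 1, 1, 1, 1] s := by
  rw [distinctSum_cons]
  simp only [pickings, mergedSum_mk, List.map_cons, List.map_nil, List.sum_cons, List.sum_nil,
    Nat.reduceAdd]
  ring

-- The variables are `t` and the `z i + t`. The increase vanishes at `t = 0`, so it is `t` times a
-- form of degree seven in `t` and `z`. Up to the factor 363 it is the sum of the three lists below;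
-- all coefficients are affine in `r`. The cases of four to seven remaining variables follow the
-- same pattern.
set_option maxHeartbeats 4000000 in
theorem residualForm_le_of_card_three {r : ℝ} (h₁ : 2.236 ≤ r) (h₂ : r ≤ 2.2361) {z : ι → ℝ}
    (hz : ∀ i, 0 ≤ z i) {s : Finset ι} (hs : s.card = 3) {t : ℝ} (ht : 0 ≤ t) :
    residualForm r (shiftedPowerSum z s t) ≤
      residualForm r (fun k => shiftedPowerSum z s t k + t ^ k) := by
  -- An entry `(a, b, c, i, j, k, l)` stands for `a t ^ i M(u) + b t ^ j M(v) - 2 c t ^ k M(w)` with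
  -- `c ^ 2 ≤ a b`. These supply the negative coefficients of the increase.
  have hA := sum_amGmValue_nonneg hz s ht
    [(1202102, 134824, 402581, 3, 1, 2, [(3, 5, 4), (2, 2, 2)]),
      (281176, 281176, 281176, 5, 3, 4, [(3, 5, 4)]),
      (4611260, 604899, 1569739, 4, 2, 3, [(3, 5, 4), (1, 1, 1)]),
      (11486, 1172403, 115630, 1, 1, 1, [(5, 3, 4), (2, 2, 2), (0, 2, 1)]),
      (178860, 934384, 403559, 1, 1, 1, [(5, 3, 4), (1, 3, 2), (1, 1, 1)]),
      (11286573, 73379, 853242, 6, 2, 4, [(2, 6, 4)]),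
      (152310, 6046796, 958305, 3, 3, 3, [(5, 3, 4), (0, 2, 1)]),
      (654353, 2369806, 1240128, 2, 2, 2, [(5, 3, 4), (1, 3, 2)]),
      (71761, 8650094, 775211, 2, 2, 2, [(5, 3, 4), (0, 2, 1), (1, 1, 1)]),
      (617, 146364, 9500, 1, 1, 1, [(7, 5, 6), (0, 2, 1)]),
      (1496, 2198990, 57355, 2, 2, 2, [(6, 2, 4), (0, 2, 1), (0, 2, 1)]),
      (975284, 5882, 75698, 3, 1, 2, [(5, 7, 6)]),
      (68266, 68266, 68266, 1, 1, 1, [(5, 3, 4), (2, 4, 3)])]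
    (by
      simp only [List.forall_mem_cons, List.not_mem_nil, false_imp_iff, implies_true, and_true]
      norm_num)
  -- What the mean inequalities leave over on at most three distinct indices. Each coefficient `a +
  -- b r` is affine in `r`, so its sign follows from the two bounds on `r`.
  have hB := sum_monomialValue_nonneg (r := r) hz s ht
    [(144, 0, 1, [7]), (4579, -1881, 1, [6, 1]), (-149168, 70004, 1, [5, 2]),
      (-72171/2, 35541/2, 1, [5, 1, 1]), (260711, -115995, 1, [4, 3]),
      (337299, -141739, 1, [4, 2, 1]), (-660555, 303937, 1, [3, 3, 1]),
      (257048, -104255, 1, [3, 2, 2]), (9883, -3762, 2, [6]), (-496674, 234267, 2, [5, 1]),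
      (-324963, 174137, 2, [4, 2]), (626307, -265495, 2, [4, 1, 1]), (681886, -283320, 2, [3, 3]),
      (-1234730, 631136, 2, [3, 2, 1]), (471257, -190683, 2, [2, 2, 2]),
      (-623275, 292985, 3, [5]), (-1681432, 796296, 3, [4, 1]), (771970, -279076, 3, [3, 2]),
      (7769366, 53834, 3, [3, 1, 1]), (19997273, 323881, 3, [2, 2, 1]),
      (-2772600, 1259840, 4, [4]), (-2117295, 988969, 4, [3, 1]),
      (39146455/2, -810767/2, 4, [2, 2]), (79689175/2, 931451/2, 4, [2, 1, 1]),
      (-3979306, 1782166, 5, [3]), (53195946, 235854, 5, [2, 1]),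
      (23415323, 240407, 5, [1, 1, 1]), (14327144, 872225, 6, [2]),
      (86459925/2, 232249/2, 6, [1, 1]), (45461680, 212608, 7, [1]), (22995522, 79728, 8, [])]
    (by
      simp only [List.forall_mem_cons, List.not_mem_nil, false_imp_iff, implies_true, and_true]
      repeat' constructor
      all_goals linarith)
  -- The terms on four or more distinct indices; they vanish, so negative coefficients do no harm.
  have hC := sum_monomialValue_eq_zero r z t (s := s)
    [(8355/2, -58095/2, 1, [4, 1, 1, 1]), (1405140, -11715, 1, [3, 2, 1, 1]),
      (611895/4, 70185/4, 1, [3, 1, 1, 1, 1]), (-767937, -11015, 1, [2, 2, 2, 1]),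
      (159487/2, -63971/2, 1, [2, 2, 1, 1, 1]), (203893/4, -13209/4, 1, [2, 1, 1, 1, 1, 1]),
      (2904, 0, 1, [1, 1, 1, 1, 1, 1, 1]), (2683475, -213710, 2, [3, 1, 1, 1]),
      (-1783338, -21801, 2, [2, 2, 1, 1]), (616069/2, -116547/2, 2, [2, 1, 1, 1, 1]),
      (1186993/24, -57239/8, 2, [1, 1, 1, 1, 1, 1]), (-1370137, -258442, 3, [2, 1, 1, 1]),
      (61559/2, -49051/2, 3, [1, 1, 1, 1, 1]), (-12346473/8, -1112363/8, 4, [1, 1, 1, 1])]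
    (by
      rw [hs]
      simp)
  -- The number of remaining variables enters the shifted power sums as the power sum of exponent 0.
  have h0 : powerSum z s 0 = 3 := by simp [powerSum, hs]
  simp only [List.map_cons, List.map_nil, List.sum_cons, List.sum_nil, amGmValue,
    monomialValue, distinctSum_one_replicate_seven, distinctSum_two_replicate_five,
    distinctSum_one_replicate_six, distinctSum_two_two_replicate_three,
    distinctSum_three_replicate_four, distinctSum_two_replicate_four,
    distinctSum_one_replicate_five] at hA hB hC
  simp only [distinctSum_cons, distinctSum_nil, pickings, mergedSum_mk, List.map_cons,
    List.map_nil, List.sum_cons, List.sum_nil, Nat.reduceAdd, h0] at hA hB hC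
  simp only [residualForm, shiftedPowerSum, Finset.sum_range_succ, Finset.sum_range_zero,
    Nat.choose, Nat.reduceAdd, Nat.reduceSub, h0]
  push_cast
  -- The sum in `hC` stands on the left of its equation, hence the minus sign.
  linear_combination (1 / 363) * hA + (1 / 363) * hB - (1 / 363) * hC

set_option maxHeartbeats 4000000 in
theorem residualForm_le_of_card_four {r : ℝ} (h₁ : 2.236 ≤ r) (h₂ : r ≤ 2.2361) {z : ι → ℝ}
    (hz : ∀ i, 0 ≤ z i) {s : Finset ι} (hs : s.card = 4) {t : ℝ} (ht : 0 ≤ t) :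
    residualForm r (shiftedPowerSum z s t) ≤
      residualForm r (fun k => shiftedPowerSum z s t k + t ^ k) := by
  have hA := sum_amGmValue_nonneg hz s ht
    [(2971077, 160699, 690976, 3, 1, 2, [(3, 5, 4), (2, 2, 2)]),
      (907, 107437, 9500, 1, 1, 1, [(7, 5, 6), (0, 2, 1)]),
      (3703772, 861379, 1786155, 4, 2, 3, [(3, 5, 4), (1, 1, 1)]),
      (194931, 838168, 404209, 1, 1, 1, [(2, 2, 2), (3, 1, 2), (1, 3, 2), (1, 1, 1)]),
      (68266, 68266, 68266, 1, 1, 1, [(5, 3, 4), (2, 4, 3)]),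
      (175750, 934384, 399753, 1, 1, 1, [(5, 3, 4), (1, 3, 2), (1, 1, 1)]),
      (3110, 318266, 30995, 1, 1, 1, [(5, 3, 4), (0, 2, 1), (1, 1, 1), (1, 1, 1)]),
      (12269, 1172403, 119436, 1, 1, 1, [(5, 3, 4), (2, 2, 2), (0, 2, 1)]),
      (503000, 4394, 47012, 3, 1, 2, [(5, 7, 6)]),
      (673908, 3304190, 1470921, 2, 2, 2, [(5, 3, 4), (1, 3, 2)]),
      (59873, 1362401, 278647, 2, 2, 2, [(2, 2, 2), (2, 2, 2), (2, 0, 1), (0, 2, 1)]),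
      (334479, 13285841, 2073810, 3, 3, 3, [(5, 3, 4), (0, 2, 1)]),
      (76723, 11352826, 925555, 2, 2, 2, [(5, 3, 4), (0, 2, 1), (1, 1, 1)]),
      (149573, 2765376, 643137, 2, 2, 2, [(3, 1, 2), (1, 3, 2), (1, 1, 1), (1, 1, 1)]),
      (5079, 7464366, 194701, 3, 3, 3, [(2, 2, 2), (1, 1, 1), (2, 0, 1), (0, 2, 1)]),
      (5944218, 1382435, 2866617, 5, 3, 4, [(3, 5, 4)]),
      (10407, 15296193, 398983, 4, 4, 4, [(1, 1, 1), (1, 1, 1), (2, 0, 1), (0, 2, 1)])]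
    (by
      simp only [List.forall_mem_cons, List.not_mem_nil, false_imp_iff, implies_true, and_true]
      norm_num)
  have hB := sum_monomialValue_nonneg (r := r) hz s ht
    [(145, 0, 1, [7]), (4579, -1881, 1, [6, 1]), (-149168, 70004, 1, [5, 2]),
      (-72171/2, 35541/2, 1, [5, 1, 1]), (260711, -115995, 1, [4, 3]),
      (337299, -141739, 1, [4, 2, 1]), (132335/2, -58095/2, 1, [4, 1, 1, 1]),
      (-660555, 303937, 1, [3, 3, 1]), (257048, -104255, 1, [3, 2, 2]),
      (53775, -11715, 1, [3, 2, 1, 1]), (40481, -11015, 1, [2, 2, 2, 1]), (14461, -5643, 2, [6]),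
      (-568845, 269808, 2, [5, 1]), (12334, 32398, 2, [4, 2]),
      (1649635/2, -705275/2, 2, [4, 1, 1]), (21331, 20617, 2, [3, 3]),
      (-1127182, 607706, 2, [3, 2, 1]), (380421, -143525, 2, [3, 1, 1, 1]),
      (480036, -201698, 2, [2, 2, 2]), (598921/2, -235515/2, 2, [2, 2, 1, 1]),
      (-1042951, 492789, 3, [5]), (-369096, 232760, 3, [4, 1]), (-869308, 537140, 3, [3, 2]),
      (16250336, -365026, 3, [3, 1, 1]), (11743424, 121411, 3, [2, 2, 1]),
      (1111381, -493610, 3, [2, 1, 1, 1]), (-2893323, 1344207, 4, [4]),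
      (21612879, 259085, 4, [3, 1]), (69017235/2, 433733/2, 4, [2, 2]),
      (62394559/2, -1582609/2, 4, [2, 1, 1]), (6698739/8, -2939815/8, 4, [1, 1, 1, 1]),
      (6745290, 1661340, 5, [3]), (118704690, -840132, 5, [2, 1]),
      (26142042, -850368, 5, [1, 1, 1]), (95212014, 173106, 6, [2]),
      (92571612, -1638293, 6, [1, 1]), (146440200, -1925832, 7, [1]), (97472517, -1203645, 8, [])]
    (by
      simp only [List.forall_mem_cons, List.not_mem_nil, false_imp_iff, implies_true, and_true]
      repeat' constructor
      all_goals linarith)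
  have hC := sum_monomialValue_eq_zero r z t (s := s)
    [(611895/4, 70185/4, 1, [3, 1, 1, 1, 1]), (159487/2, -63971/2, 1, [2, 2, 1, 1, 1]),
      (203893/4, -13209/4, 1, [2, 1, 1, 1, 1, 1]), (2904, 0, 1, [1, 1, 1, 1, 1, 1, 1]),
      (2251603/4, -299139/4, 2, [2, 1, 1, 1, 1]), (1674865/24, -57239/8, 2, [1, 1, 1, 1, 1, 1]),
      (797045/2, -128305/2, 3, [1, 1, 1, 1, 1])]
    (by
      rw [hs]
      simp)
  have h0 : powerSum z s 0 = 4 := by simp [powerSum, hs]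
  simp only [List.map_cons, List.map_nil, List.sum_cons, List.sum_nil, amGmValue,
    monomialValue, distinctSum_one_replicate_seven, distinctSum_two_replicate_five,
    distinctSum_one_replicate_six, distinctSum_two_two_replicate_three,
    distinctSum_three_replicate_four, distinctSum_two_replicate_four,
    distinctSum_one_replicate_five] at hA hB hC
  simp only [distinctSum_cons, distinctSum_nil, pickings, mergedSum_mk, List.map_cons,
    List.map_nil, List.sum_cons, List.sum_nil, Nat.reduceAdd, h0] at hA hB hC
  simp only [residualForm, shiftedPowerSum, Finset.sum_range_succ, Finset.sum_range_zero,
    Nat.choose, Nat.reduceAdd, Nat.reduceSub, h0]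
  push_cast
  linear_combination (1 / 363) * hA + (1 / 363) * hB - (1 / 363) * hC

set_option maxHeartbeats 4000000 in
theorem residualForm_le_of_card_five {r : ℝ} (h₁ : 2.236 ≤ r) (h₂ : r ≤ 2.2361) {z : ι → ℝ}
    (hz : ∀ i, 0 ≤ z i) {s : Finset ι} (hs : s.card = 5) {t : ℝ} (ht : 0 ≤ t) :
    residualForm r (shiftedPowerSum z s t) ≤
      residualForm r (fun k => shiftedPowerSum z s t k + t ^ k) := by
  have hA := sum_amGmValue_nonneg hz s ht
    [(1167764, 4238573, 2166856, 2, 2, 2, [(5, 3, 4), (1, 3, 2)]),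
      (688, 136582, 9500, 1, 1, 1, [(7, 5, 6), (0, 2, 1)]),
      (786276, 4364, 56512, 3, 1, 2, [(5, 7, 6)]),
      (12166, 1172403, 118935, 1, 1, 1, [(5, 3, 4), (2, 2, 2), (0, 2, 1)]),
      (68266, 68266, 68266, 1, 1, 1, [(5, 3, 4), (2, 4, 3)]),
      (172786, 934384, 400253, 1, 1, 1, [(5, 3, 4), (1, 3, 2), (1, 1, 1)]),
      (3037, 318266, 30995, 1, 1, 1, [(5, 3, 4), (0, 2, 1), (1, 1, 1), (1, 1, 1)]),
      (194931, 838168, 404209, 1, 1, 1, [(2, 2, 2), (3, 1, 2), (1, 3, 2), (1, 1, 1)]),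
      (190354, 3478052, 812009, 2, 2, 2, [(3, 1, 2), (1, 3, 2), (1, 1, 1), (1, 1, 1)]),
      (12119813, 655535, 2818680, 4, 2, 3, [(3, 5, 4), (1, 1, 1)]),
      (272173, 25756570, 2559176, 3, 3, 3, [(5, 3, 4), (0, 2, 1)]),
      (2211098, 119594, 514231, 3, 1, 2, [(3, 5, 4), (2, 2, 2)]),
      (74385, 14055557, 1018540, 2, 2, 2, [(5, 3, 4), (0, 2, 1), (1, 1, 1)]),
      (32551, 290228, 97196, 2, 2, 2, [(2, 2, 2), (2, 2, 2), (2, 0, 1), (0, 2, 1)]),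
      (11607019, 2699422, 5597521, 5, 3, 4, [(3, 5, 4)])]
    (by
      simp only [List.forall_mem_cons, List.not_mem_nil, false_imp_iff, implies_true, and_true]
      norm_num)
  have hB := sum_monomialValue_nonneg (r := r) hz s ht
    [(144, 0, 1, [7]), (4579, -1881, 1, [6, 1]), (-149168, 70004, 1, [5, 2]),
      (-72171/2, 35541/2, 1, [5, 1, 1]), (260711, -115995, 1, [4, 3]),
      (337297, -141739, 1, [4, 2, 1]), (132335/2, -58095/2, 1, [4, 1, 1, 1]),
      (-660555, 303937, 1, [3, 3, 1]), (257048, -104255, 1, [3, 2, 2]),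
      (53775, -11715, 1, [3, 2, 1, 1]), (611895/4, 70185/4, 1, [3, 1, 1, 1, 1]),
      (40481, -11015, 1, [2, 2, 2, 1]), (159487/2, -63971/2, 1, [2, 2, 1, 1, 1]),
      (19040, -7524, 2, [6]), (-641017, 305349, 2, [5, 1]), (349635, -109341, 2, [4, 2]),
      (1023320, -439780, 2, [4, 1, 1]), (-639223, 324554, 2, [3, 3]),
      (-1019633, 584276, 2, [3, 2, 1]), (238859, -73340, 2, [3, 1, 1, 1]),
      (488815, -212713, 2, [2, 2, 2]), (513533, -213714, 2, [2, 2, 1, 1]),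
      (817767, -91296, 2, [2, 1, 1, 1, 1]), (-1534804, 728134, 3, [5]),
      (1340245, -505061, 3, [4, 1]), (-2403036, 1329926, 3, [3, 2]),
      (26566991, -573331, 3, [3, 1, 1]), (18906926, -272972, 3, [2, 2, 1]),
      (3833560, -794823, 3, [2, 1, 1, 1]), (1776467/2, -207559/2, 3, [1, 1, 1, 1, 1]),
      (-1641998, 832492, 4, [4]), (53842554, -863979, 4, [3, 1]),
      (102883751/2, 955557/2, 4, [2, 2]), (124038907/2, -5520121/2, 4, [2, 1, 1]),
      (30526005/8, -6220257/8, 4, [1, 1, 1, 1]), (48486479, 232538, 5, [3]),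
      (218666748, -5088294, 5, [2, 1]), (41474572, -3209966, 5, [1, 1, 1]),
      (241783954, -4361474, 6, [2]), (182699400, -8623911, 6, [1, 1]),
      (369969944, -14137048, 7, [1]), (301729875, -10843515, 8, [])]
    (by
      simp only [List.forall_mem_cons, List.not_mem_nil, false_imp_iff, implies_true, and_true]
      repeat' constructor
      all_goals linarith)
  have hC := sum_monomialValue_eq_zero r z t (s := s)
    [(203893/4, -13209/4, 1, [2, 1, 1, 1, 1, 1]), (2904, 0, 1, [1, 1, 1, 1, 1, 1, 1]),
      (2162737/24, -57239/8, 2, [1, 1, 1, 1, 1, 1])]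
    (by
      rw [hs]
      simp)
  have h0 : powerSum z s 0 = 5 := by simp [powerSum, hs]
  simp only [List.map_cons, List.map_nil, List.sum_cons, List.sum_nil, amGmValue,
    monomialValue, distinctSum_one_replicate_seven, distinctSum_two_replicate_five,
    distinctSum_one_replicate_six, distinctSum_two_two_replicate_three,
    distinctSum_three_replicate_four, distinctSum_two_replicate_four,
    distinctSum_one_replicate_five] at hA hB hC
  simp only [distinctSum_cons, distinctSum_nil, pickings, mergedSum_mk, List.map_cons,
    List.map_nil, List.sum_cons, List.sum_nil, Nat.reduceAdd, h0] at hA hB hC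
  simp only [residualForm, shiftedPowerSum, Finset.sum_range_succ, Finset.sum_range_zero,
    Nat.choose, Nat.reduceAdd, Nat.reduceSub, h0]
  push_cast
  linear_combination (1 / 363) * hA + (1 / 363) * hB - (1 / 363) * hC

set_option maxHeartbeats 4000000 in
theorem residualForm_le_of_card_six {r : ℝ} (h₁ : 2.236 ≤ r) (h₂ : r ≤ 2.2361) {z : ι → ℝ}
    (hz : ∀ i, 0 ≤ z i) {s : Finset ι} (hs : s.card = 6) {t : ℝ} (ht : 0 ≤ t) :
    residualForm r (shiftedPowerSum z s t) ≤
      residualForm r (fun k => shiftedPowerSum z s t k + t ^ k) := by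
  have hA := sum_amGmValue_nonneg hz s ht
    [(998514, 5172957, 2263317, 2, 2, 2, [(5, 3, 4), (1, 3, 2)]),
      (709, 137246, 9500, 1, 1, 1, [(7, 5, 6), (0, 2, 1)]),
      (74881, 16583836, 1111526, 2, 2, 2, [(5, 3, 4), (0, 2, 1), (1, 1, 1)]),
      (12030, 1172403, 118273, 1, 1, 1, [(5, 3, 4), (2, 2, 2), (0, 2, 1)]),
      (68266, 68266, 68266, 1, 1, 1, [(5, 3, 4), (2, 4, 3)]),
      (173372, 934384, 400916, 1, 1, 1, [(5, 3, 4), (1, 3, 2), (1, 1, 1)]),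
      (336841, 485051, 404209, 1, 1, 1, [(2, 2, 2), (3, 1, 2), (1, 3, 2), (1, 1, 1)]),
      (1829, 529473, 30995, 1, 1, 1, [(5, 3, 4), (0, 2, 1), (1, 1, 1), (1, 1, 1)]),
      (8717281, 107309, 936959, 3, 1, 2, [(3, 5, 4), (2, 2, 2)]),
      (161889, 33663869, 2325541, 3, 3, 3, [(5, 3, 4), (0, 2, 1)]),
      (20450698, 1106135, 4756178, 4, 2, 3, [(3, 5, 4), (1, 1, 1)]),
      (198938, 4222925, 896626, 2, 2, 2, [(3, 1, 2), (1, 3, 2), (1, 1, 1), (1, 1, 1)]),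
      (32917, 141535, 68256, 2, 2, 2, [(2, 2, 2), (3, 1, 2), (1, 3, 2)]),
      (1220457, 3570, 66007, 3, 1, 2, [(5, 7, 6)]),
      (19726361, 4587721, 9513098, 5, 3, 4, [(3, 5, 4)])]
    (by
      simp only [List.forall_mem_cons, List.not_mem_nil, false_imp_iff, implies_true, and_true]
      norm_num)
  have hB := sum_monomialValue_nonneg (r := r) hz s ht
    [(145, 0, 1, [7]), (4579, -1881, 1, [6, 1]), (-149169, 70004, 1, [5, 2]),
      (-72169/2, 35541/2, 1, [5, 1, 1]), (260711, -115995, 1, [4, 3]),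
      (337299, -141739, 1, [4, 2, 1]), (132335/2, -58095/2, 1, [4, 1, 1, 1]),
      (-660555, 303937, 1, [3, 3, 1]), (257048, -104255, 1, [3, 2, 2]),
      (53775, -11715, 1, [3, 2, 1, 1]), (611895/4, 70185/4, 1, [3, 1, 1, 1, 1]),
      (40481, -11015, 1, [2, 2, 2, 1]), (159487/2, -63971/2, 1, [2, 2, 1, 1, 1]),
      (203893/4, -13209/4, 1, [2, 1, 1, 1, 1, 1]), (23609, -9405, 2, [6]),
      (-713187, 340890, 2, [5, 1]), (686934, -251080, 2, [4, 2]),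
      (2443649/2, -1053845/2, 2, [4, 1, 1]), (-1299778, 628491, 2, [3, 3]),
      (-912084, 560846, 2, [3, 2, 1]), (97297, -3155, 2, [3, 1, 1, 1]),
      (502948, -223728, 2, [2, 2, 2]), (1455211/2, -619341/2, 2, [2, 2, 1, 1]),
      (4290533/4, -431229/4, 2, [2, 1, 1, 1, 1]), (2650609/24, -57239/8, 2, [1, 1, 1, 1, 1, 1]),
      (-2098823, 999020, 3, [5]), (3446595, -1417167, 3, [4, 1]), (-3829216, 2099282, 3, [3, 2]),
      (38719331, -571081, 3, [3, 1, 1]), (19079444, -859268, 3, [2, 2, 1]),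
      (7964606, -1162081, 3, [2, 1, 1, 1]), (2999825/2, -286813/2, 3, [1, 1, 1, 1, 1]),
      (1378376, -449590, 4, [4]), (107651785, -1959113, 4, [3, 1]),
      (141702925/2, 370879/2, 4, [2, 2]), (178899409/2, -11277355/2, 4, [2, 1, 1]),
      (83165229/8, -10953689/8, 4, [1, 1, 1, 1]), (137471599, -2452880, 5, [3]),
      (375954552, -13944528, 5, [2, 1]), (79607563, -7498837, 5, [1, 1, 1]),
      (520512905, -16256515, 6, [2]), (743871435/2, -51016265/2, 6, [1, 1]),
      (878411560, -51407960, 7, [1]), (839108775, -46989825, 8, [])]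
    (by
      simp only [List.forall_mem_cons, List.not_mem_nil, false_imp_iff, implies_true, and_true]
      repeat' constructor
      all_goals linarith)
  have hC := sum_monomialValue_eq_zero r z t (s := s)
    [(2904, 0, 1, [1, 1, 1, 1, 1, 1, 1])]
    (by
      rw [hs]
      simp)
  have h0 : powerSum z s 0 = 6 := by simp [powerSum, hs]
  simp only [List.map_cons, List.map_nil, List.sum_cons, List.sum_nil, amGmValue,
    monomialValue, distinctSum_one_replicate_seven, distinctSum_two_replicate_five,
    distinctSum_one_replicate_six, distinctSum_two_two_replicate_three,
    distinctSum_three_replicate_four, distinctSum_two_replicate_four,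
    distinctSum_one_replicate_five] at hA hB hC
  simp only [distinctSum_cons, distinctSum_nil, pickings, mergedSum_mk, List.map_cons,
    List.map_nil, List.sum_cons, List.sum_nil, Nat.reduceAdd, h0] at hA hB hC
  simp only [residualForm, shiftedPowerSum, Finset.sum_range_succ, Finset.sum_range_zero,
    Nat.choose, Nat.reduceAdd, Nat.reduceSub, h0]
  push_cast
  linear_combination (1 / 363) * hA + (1 / 363) * hB - (1 / 363) * hC

set_option maxHeartbeats 4000000 in
theorem residualForm_le_of_card_seven {r : ℝ} (h₁ : 2.236 ≤ r) (h₂ : r ≤ 2.2361) {z : ι → ℝ}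
    (hz : ∀ i, 0 ≤ z i) {s : Finset ι} (hs : s.card = 7) {t : ℝ} (ht : 0 ≤ t) :
    residualForm r (shiftedPowerSum z s t) ≤
      residualForm r (fun k => shiftedPowerSum z s t k + t ^ k) := by
  have hA := sum_amGmValue_nonneg hz s ht
    [(49961508, 4975351, 14799320, 5, 3, 4, [(3, 5, 4)]),
      (713, 135172, 9500, 1, 1, 1, [(7, 5, 6), (0, 2, 1)]),
      (1149732, 6107341, 2496841, 2, 2, 2, [(5, 3, 4), (1, 3, 2)]),
      (336841, 485051, 404209, 1, 1, 1, [(2, 2, 2), (3, 1, 2), (1, 3, 2), (1, 1, 1)]),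
      (171543, 934384, 398846, 1, 1, 1, [(5, 3, 4), (1, 3, 2), (1, 1, 1)]),
      (22333429, 1207968, 5194041, 4, 2, 3, [(3, 5, 4), (1, 1, 1)]),
      (1829, 529473, 30995, 1, 1, 1, [(5, 3, 4), (0, 2, 1), (1, 1, 1), (1, 1, 1)]),
      (12455, 1172403, 120342, 1, 1, 1, [(5, 3, 4), (2, 2, 2), (0, 2, 1)]),
      (338809, 43799880, 3777511, 3, 3, 3, [(5, 3, 4), (0, 2, 1)]),
      (2010375, 2836, 75507, 3, 1, 2, [(5, 7, 6)]),
      (80839, 18253467, 1204511, 2, 2, 2, [(5, 3, 4), (0, 2, 1), (1, 1, 1)]),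
      (227848, 979704, 472465, 2, 2, 2, [(2, 2, 2), (3, 1, 2), (1, 3, 2)]),
      (68266, 68266, 68266, 1, 1, 1, [(5, 3, 4), (2, 4, 3)]),
      (174306, 5001014, 884047, 2, 2, 2, [(3, 1, 2), (1, 3, 2), (1, 1, 1), (1, 1, 1)]),
      (15697482, 95226, 1222623, 3, 1, 2, [(3, 5, 4), (2, 2, 2)])]
    (by
      simp only [List.forall_mem_cons, List.not_mem_nil, false_imp_iff, implies_true, and_true]
      norm_num)
  have hB := sum_monomialValue_nonneg (r := r) hz s ht
    [(146, 0, 1, [7]), (4579, -1881, 1, [6, 1]), (-149167, 70004, 1, [5, 2]),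
      (-72169/2, 35541/2, 1, [5, 1, 1]), (260711, -115995, 1, [4, 3]),
      (337297, -141739, 1, [4, 2, 1]), (132335/2, -58095/2, 1, [4, 1, 1, 1]),
      (-660555, 303937, 1, [3, 3, 1]), (257048, -104255, 1, [3, 2, 2]),
      (53775, -11715, 1, [3, 2, 1, 1]), (611895/4, 70185/4, 1, [3, 1, 1, 1, 1]),
      (40481, -11015, 1, [2, 2, 2, 1]), (159487/2, -63971/2, 1, [2, 2, 1, 1, 1]),
      (203893/4, -13209/4, 1, [2, 1, 1, 1, 1, 1]), (2904, 0, 1, [1, 1, 1, 1, 1, 1, 1]),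
      (28188, -11286, 2, [6]), (-785360, 376431, 2, [5, 1]), (1024231, -392819, 2, [4, 2]),
      (1420327, -614065, 2, [4, 1, 1]), (-1960333, 932428, 2, [3, 3]),
      (-804535, 537416, 2, [3, 2, 1]), (-44265, 67030, 2, [3, 1, 1, 1]),
      (543429, -234743, 2, [2, 2, 2]), (941678, -405627, 2, [2, 2, 1, 1]),
      (2654999/2, -248637/2, 2, [2, 1, 1, 1, 1]), (3138481/24, -57239/8, 2, [1, 1, 1, 1, 1, 1]),
      (-2735017, 1305447, 3, [5]), (5949950, -2503558, 3, [4, 1]), (-5147846, 2845208, 3, [3, 2]),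
      (52707356, -358276, 3, [3, 1, 1]), (19730423, -1637477, 3, [2, 2, 1]),
      (13115117, -1595384, 3, [2, 1, 1, 1]), (4467119/2, -366067/2, 3, [1, 1, 1, 1, 1]),
      (6564808, -2676324, 4, [4]), (193074940, -2605207, 4, [3, 1]),
      (186431679/2, -1704127/2, 4, [2, 2]), (263706055/2, -19250581/2, 4, [2, 1, 1]),
      (163111403/8, -17140111/8, 4, [1, 1, 1, 1]), (276396876, -5922444, 5, [3]),
      (619557324, -29241000, 5, [2, 1]), (153175025, -14377431, 5, [1, 1, 1]),
      (1014614535, -40485357, 6, [2]), (1506893181/2, -117483151/2, 6, [1, 1]),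
      (1995139896, -139373448, 7, [1]), (2175440001, -147807303, 8, [])]
    (by
      simp only [List.forall_mem_cons, List.not_mem_nil, false_imp_iff, implies_true, and_true]
      repeat' constructor
      all_goals linarith)
  -- After the factor `t`, a term has at most seven distinct indices, so with seven variables no
  -- vanishing terms occur.
  have h0 : powerSum z s 0 = 7 := by simp [powerSum, hs]
  simp only [List.map_cons, List.map_nil, List.sum_cons, List.sum_nil, amGmValue,
    monomialValue, distinctSum_one_replicate_seven, distinctSum_two_replicate_five,
    distinctSum_one_replicate_six, distinctSum_two_two_replicate_three,
    distinctSum_three_replicate_four, distinctSum_two_replicate_four,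
    distinctSum_one_replicate_five] at hA hB
  simp only [distinctSum_cons, distinctSum_nil, pickings, mergedSum_mk, List.map_cons,
    List.map_nil, List.sum_cons, List.sum_nil, Nat.reduceAdd, h0] at hA hB
  simp only [residualForm, shiftedPowerSum, Finset.sum_range_succ, Finset.sum_range_zero,
    Nat.choose, Nat.reduceAdd, Nat.reduceSub, h0]
  push_cast
  linear_combination (1 / 363) * hA + (1 / 363) * hB

end ResidualForm

/-! ### Nonnegativity of the symmetric form -/

section Nonnegativity

/-- The symmetric form of degree eight in three variables, in terms of the elementary symmetric
functions of its variables. -/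
noncomputable def ternaryForm (r p q e : ℝ) : ℝ :=
  20 * p ^ 6 * q - 360 * p ^ 4 * q ^ 2 + 2100 * p ^ 2 * q ^ 3 - 3920 * q ^ 4 +
    e * ((4623 - 57 * r) / 11 * p ^ 5 + (-125333 + 7219 * r) / 33 * p ^ 3 * q +
      (29764 / 3 - 924 * r) * p * q ^ 2) +
    e ^ 2 * ((-136228 + 14134 * r) / 11 * p ^ 2 + (77200 - 3296 * r) / 3 * q)

theorem residualForm_three (r x y z : ℝ) :
    residualForm r (fun k => x ^ k + y ^ k + z ^ k) =
      ternaryForm r (x + y + z) (x * y + y * z + z * x) (x * y * z) := by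
  simp only [residualForm, ternaryForm]
  ring

/-- The variables are `a + c`, `c`, `c`. At the interior node of the triangle the sum of squares
equals 1, so the form has a zero there. This node has `a = (1 + √5) / 2 * c`, which accounts for the
squared factor. -/
theorem ternaryForm_two_small_nonneg {r : ℝ} (hr : r ^ 2 = 5) (h₁ : 2.236 ≤ r) (h₂ : r ≤ 2.2361)
    {a c : ℝ} (ha : 0 ≤ a) (hc : 0 ≤ c) :
    0 ≤ ternaryForm r (a + 3 * c) (2 * a * c + 3 * c ^ 2) ((a + c) * c ^ 2) := by
  have key : ternaryForm r (a + 3 * c) (2 * a * c + 3 * c ^ 2) ((a + c) * c ^ 2) =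
      c * (a - (1 + r) / 2 * c) ^ 2 *
        (40 * a ^ 5 + (-2197 + 383 * r) / 11 * a ^ 4 * c + (23852 + 5600 * r) / 33 * a ^ 3 * c ^ 2 +
          (-118796 + 99540 * r) / 33 * a ^ 2 * c ^ 3 + (-24160 + 48124 * r) / 33 * a * c ^ 4 +
          (42133 - 15655 * r) / 11 * c ^ 5) := by
    simp only [ternaryForm]
    linear_combination (-c * (c ^ 2 / 4 *
        (40 * a ^ 5 + (-2197 + 383 * r) / 11 * a ^ 4 * c + (23852 + 5600 * r) / 33 * a ^ 3 * c ^ 2 +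
          (-118796 + 99540 * r) / 33 * a ^ 2 * c ^ 3 + (-24160 + 48124 * r) / 33 * a * c ^ 4 +
          (42133 - 15655 * r) / 11 * c ^ 5) +
        (c ^ 2 / 2 - a * c) * (383 / 11 * a ^ 4 * c + 5600 / 33 * a ^ 3 * c ^ 2 +
          99540 / 33 * a ^ 2 * c ^ 3 + 48124 / 33 * a * c ^ 4 - 15655 / 11 * c ^ 5))) * hr
  rw [key]
  refine mul_nonneg (mul_nonneg hc (sq_nonneg _)) ?_
  -- Only the coefficient of `a ^ 4 * c` is negative; 40 times this square compensates it.
  have e1 : 0 ≤ a ^ 3 * (a - 2 * c) ^ 2 := by positivity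
  have e2 : 0 ≤ (383 * r - 2197 + 1760) * (a ^ 4 * c) :=
    mul_nonneg (by linarith) (by positivity)
  have e3 : 0 ≤ (23852 + 5600 * r - 160 * 33) * (a ^ 3 * c ^ 2) :=
    mul_nonneg (by linarith) (by positivity)
  have e4 : 0 ≤ (-118796 + 99540 * r) * (a ^ 2 * c ^ 3) :=
    mul_nonneg (by linarith) (by positivity)
  have e5 : 0 ≤ (-24160 + 48124 * r) * (a * c ^ 4) := mul_nonneg (by linarith) (by positivity)
  have e6 : 0 ≤ (42133 - 15655 * r) * c ^ 5 := mul_nonneg (by linarith) (by positivity)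
  linarith

/-- The variables are `b + c`, `b + c`, `c`. The factor `c` reflects the zero of the form at the
midpoint of an edge. -/
theorem ternaryForm_two_large_nonneg {r : ℝ} (h₁ : 2.236 ≤ r) (h₂ : r ≤ 2.2361)
    {b c : ℝ} (hb : 0 ≤ b) (hc : 0 ≤ c) :
    0 ≤ ternaryForm r (2 * b + 3 * c) (b ^ 2 + 4 * b * c + 3 * c ^ 2) ((b + c) ^ 2 * c) := by
  have key : ternaryForm r (2 * b + 3 * c) (b ^ 2 + 4 * b * c + 3 * c ^ 2) ((b + c) ^ 2 * c) =
      c * ((72192 - 8704 * r) / 33 * b ^ 7 + (2020 - 1232 / 3 * r) * b ^ 6 * c +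
        (-287510 + 35554 * r) / 33 * b ^ 5 * c ^ 2 + (-386647 + 83851 * r) / 33 * b ^ 4 * c ^ 3 +
        (236856 + 26192 * r) / 33 * b ^ 3 * c ^ 4 + (654331 - 48665 * r) / 33 * b ^ 2 * c ^ 5 +
        (384992 - 38656 * r) / 33 * b * c ^ 6 + (24062 - 2416 * r) / 11 * c ^ 7) := by
    simp only [ternaryForm]
    ring
  rw [key]
  refine mul_nonneg hc ?_
  -- The coefficients of `b ^ 5 * c ^ 2` and `b ^ 4 * c ^ 3` are negative. They are offset by 1590
  -- times this square and 1100 times the next one.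
  have e1 : 0 ≤ b ^ 3 * (b ^ 2 - 2 * c ^ 2) ^ 2 := by positivity
  have e2 : 0 ≤ b ^ 2 * c * (b ^ 2 - 2.75 * c ^ 2) ^ 2 := by positivity
  have f7 : 0 ≤ (72192 - 8704 * r - 33 * 1590) * b ^ 7 := mul_nonneg (by linarith) (by positivity)
  have f6 : 0 ≤ (2020 * 33 - 1232 * 11 * r - 33 * 1100) * (b ^ 6 * c) :=
    mul_nonneg (by linarith) (by positivity)
  have f5 : 0 ≤ (-287510 + 35554 * r + 33 * 4 * 1590) * (b ^ 5 * c ^ 2) :=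
    mul_nonneg (by linarith) (by positivity)
  have f4 : 0 ≤ (-386647 + 83851 * r + 33 * 5.5 * 1100) * (b ^ 4 * c ^ 3) :=
    mul_nonneg (by linarith) (by positivity)
  have f3 : 0 ≤ (236856 + 26192 * r - 33 * 4 * 1590) * (b ^ 3 * c ^ 4) :=
    mul_nonneg (by linarith) (by positivity)
  have f2 : 0 ≤ (654331 - 48665 * r - 33 * 7.5625 * 1100) * (b ^ 2 * c ^ 5) :=
    mul_nonneg (by linarith) (by positivity)
  have f1 : 0 ≤ (384992 - 38656 * r) * (b * c ^ 6) := mul_nonneg (by linarith) (by positivity)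
  have f0 : 0 ≤ (24062 - 2416 * r) * c ^ 7 := mul_nonneg (by linarith) (by positivity)
  linarith

/-- A concave quadratic function which is nonnegative at both ends of an interval is nonnegative on
the interval. -/
theorem quadratic_nonneg_of_concave {α β γ l h e : ℝ} (hα : α ≤ 0) (hle : l ≤ e) (heh : e ≤ h)
    (hl : 0 ≤ γ + l * β + l ^ 2 * α) (hh : 0 ≤ γ + h * β + h ^ 2 * α) :
    0 ≤ γ + e * β + e ^ 2 * α := by
  rcases (hle.trans heh).eq_or_lt with heq | hlt
  · have : e = l := le_antisymm (heh.trans heq.ge) hle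
    rwa [this]
  · refine nonneg_of_mul_nonneg_right ?_ (sub_pos.2 hlt)
    have e1 := mul_nonneg (sub_nonneg.2 heh) hl
    have e2 := mul_nonneg (sub_nonneg.2 hle) hh
    have e3 := mul_nonneg (mul_nonneg (mul_nonneg (neg_nonneg.2 hα) (sub_nonneg.2 hle))
      (sub_nonneg.2 heh)) (sub_nonneg.2 hlt.le)
    linarith

theorem ternaryForm_nonneg {r : ℝ} (hr : r ^ 2 = 5) (h₁ : 2.236 ≤ r) (h₂ : r ≤ 2.2361)
    {x y z : ℝ} (hx : 0 ≤ x) (hy : 0 ≤ y) (hz : 0 ≤ z) :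
    0 ≤ ternaryForm r (x + y + z) (x * y + y * z + z * x) (x * y * z) := by
  obtain ⟨p, hp⟩ : ∃ p, p = x + y + z := ⟨_, rfl⟩
  obtain ⟨q, hq⟩ : ∃ q, q = x * y + y * z + z * x := ⟨_, rfl⟩
  obtain ⟨e, he⟩ : ∃ e, e = x * y * z := ⟨_, rfl⟩
  rw [← hp, ← hq, ← he]
  have hp0 : 0 ≤ p := by rw [hp]; positivity
  have hq0 : 0 ≤ q := by rw [hq]; positivity
  have he0 : 0 ≤ e := by rw [he]; positivity
  have hpq : 0 ≤ p ^ 2 - 3 * q := by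
    rw [hp, hq]
    nlinarith [sq_nonneg (x - y), sq_nonneg (y - z), sq_nonneg (z - x)]
  -- For given `p` and `q`, a value taken by two of the variables must be `(p - D) / 3` or `(p + D)
  -- / 3`, the roots of the derivative of `T ^ 3 - p T ^ 2 + q T - e`.
  obtain ⟨D, hD⟩ : ∃ D, D = √(p ^ 2 - 3 * q) := ⟨_, rfl⟩
  have hD0 : 0 ≤ D := hD ▸ Real.sqrt_nonneg _
  have hD2 : D ^ 2 = p ^ 2 - 3 * q := by rw [hD, Real.sq_sqrt hpq]
  have hqD : q = (p ^ 2 - D ^ 2) / 3 := by linarith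
  have hDp : D ≤ p := abs_le_of_sq_le_sq' (by linarith) hp0 |>.2
  -- The two bounds are the values of `x * y * z` when two variables coincide. The product is the
  -- discriminant divided by 27, so `e` lies between them.
  have hdisc : 0 ≤ (e - (p + D) ^ 2 * (p - 2 * D) / 27) *
      ((p - D) ^ 2 * (p + 2 * D) / 27 - e) := by
    have : (e - (p + D) ^ 2 * (p - 2 * D) / 27) * ((p - D) ^ 2 * (p + 2 * D) / 27 - e) =
        ((x - y) * (y - z) * (z - x)) ^ 2 / 27 := by
      have h4 : (e - (p + D) ^ 2 * (p - 2 * D) / 27) * ((p - D) ^ 2 * (p + 2 * D) / 27 - e) =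
          (18 * p * q * e - 4 * p ^ 3 * e + p ^ 2 * q ^ 2 - 4 * q ^ 3 - 27 * e ^ 2) / 27 := by
        rw [hqD]
        ring
      rw [h4, hp, hq, he]
      ring
    rw [this]
    positivity
  have hgap : (p + D) ^ 2 * (p - 2 * D) / 27 ≤ (p - D) ^ 2 * (p + 2 * D) / 27 := by
    have : 0 ≤ D ^ 3 := by positivity
    linarith
  have hle : (p + D) ^ 2 * (p - 2 * D) / 27 ≤ e := by
    by_contra! hlt
    nlinarith
  have heh : e ≤ (p - D) ^ 2 * (p + 2 * D) / 27 := by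
    by_contra! hlt
    nlinarith
  -- Concavity in `e`: the coefficient of `q` is positive, and `q ≤ p ^ 2 / 3`.
  have hα : (-136228 + 14134 * r) / 11 * p ^ 2 + (77200 - 3296 * r) / 3 * q ≤ 0 := by
    have e1 : 0 ≤ (77200 - 3296 * r) * (p ^ 2 - 3 * q) := mul_nonneg (by linarith) hpq
    have e2 : 0 ≤ (9 * (136228 - 14134 * r) - 11 * (77200 - 3296 * r)) * p ^ 2 :=
      mul_nonneg (by linarith) (sq_nonneg p)
    linarith
  have hhigh : 0 ≤ ternaryForm r p q ((p - D) ^ 2 * (p + 2 * D) / 27) := by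
    have h := ternaryForm_two_small_nonneg hr h₁ h₂ hD0 (c := (p - D) / 3) (by linarith)
    convert h using 1
    congr 1
    · ring
    · rw [hqD]; ring
    · ring
  rw [ternaryForm]
  -- If `2 * D ≤ p`, the lower end belongs to the nonnegative triple with third variable `(p - 2 *
  -- D) / 3`. Otherwise that bound is not positive and `e = 0` serves as the lower end.
  rcases le_total (2 * D) p with hcase | hcase
  · have h := ternaryForm_two_large_nonneg h₁ h₂ hD0 (c := (p - 2 * D) / 3) (by linarith)
    have hlow : 0 ≤ ternaryForm r p q ((p + D) ^ 2 * (p - 2 * D) / 27) := by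
      convert h using 1
      congr 1
      · ring
      · rw [hqD]; ring
      · ring
    exact quadratic_nonneg_of_concave hα hle heh hlow hhigh
  · refine quadratic_nonneg_of_concave hα he0 heh ?_ hhigh
    have h4 : 0 ≤ p ^ 2 - 4 * q := by rw [hqD]; nlinarith
    -- This is the form at `e = 0`, that is, on an edge. Its factors vanish at the vertices, the
    -- midpoint and the two outer nodes of the edge.
    have : 0 ≤ 20 * q * (p ^ 2 - 4 * q) * (p ^ 2 - 7 * q) ^ 2 := by positivity
    linarith

variable {ι : Type*} [DecidableEq ι]

theorem residualForm_powerSum_erase_le {r : ℝ} (h₁ : 2.236 ≤ r) (h₂ : r ≤ 2.2361) {x : ι → ℝ}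
    {s : Finset ι} {i : ι} (hi : i ∈ s) (hxi : 0 ≤ x i) (hmin : ∀ j ∈ s, x i ≤ x j)
    (hs₁ : 4 ≤ s.card) (hs₂ : s.card ≤ 8) :
    residualForm r (powerSum x (s.erase i)) ≤ residualForm r (powerSum x s) := by
  -- The truncation makes the differences nonnegative at all indices, as the certificates require;
  -- on `s` it changes nothing.
  have hz : ∀ j, 0 ≤ max (x j - x i) 0 := fun j => le_max_right _ _
  have h1 : powerSum x (s.erase i) =
      shiftedPowerSum (fun j => max (x j - x i) 0) (s.erase i) (x i) := by
    funext k
    rw [← powerSum_add_const, powerSum, powerSum]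
    refine Finset.sum_congr rfl fun j hj => ?_
    rw [max_eq_left (sub_nonneg.2 (hmin j (Finset.mem_of_mem_erase hj))), sub_add_cancel]
  have h2 : powerSum x s = fun k =>
      shiftedPowerSum (fun j => max (x j - x i) 0) (s.erase i) (x i) k + x i ^ k := by
    funext k
    rw [← h1, powerSum, powerSum, Finset.sum_erase_add _ _ hi]
  have hc := Finset.card_erase_of_mem hi
  rw [h2, h1]
  obtain h | h | h | h | h : s.card = 4 ∨ s.card = 5 ∨ s.card = 6 ∨ s.card = 7 ∨ s.card = 8 := by
    omega
  all_goals rw [h] at hc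
  · exact residualForm_le_of_card_three h₁ h₂ hz hc hxi
  · exact residualForm_le_of_card_four h₁ h₂ hz hc hxi
  · exact residualForm_le_of_card_five h₁ h₂ hz hc hxi
  · exact residualForm_le_of_card_six h₁ h₂ hz hc hxi
  · exact residualForm_le_of_card_seven h₁ h₂ hz hc hxi

theorem residualForm_powerSum_nonneg {r : ℝ} (hr : r ^ 2 = 5) (h₁ : 2.236 ≤ r) (h₂ : r ≤ 2.2361)
    {x : ι → ℝ} (hx : ∀ i, 0 ≤ x i) (s : Finset ι) (hs₁ : 3 ≤ s.card) (hs₂ : s.card ≤ 8) :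
    0 ≤ residualForm r (powerSum x s) := by
  obtain ⟨n, hn⟩ : ∃ n, s.card = n + 3 := ⟨s.card - 3, by omega⟩
  induction n generalizing s with
  | zero =>
    obtain ⟨a, b, c, hab, hac, hbc, rfl⟩ := Finset.card_eq_three.1 hn
    have : powerSum x {a, b, c} = fun k => x a ^ k + x b ^ k + x c ^ k := by
      funext k
      rw [powerSum, Finset.sum_insert (by simp [hab, hac]), Finset.sum_insert (by simp [hbc]),
        Finset.sum_singleton, add_assoc]
    rw [this, residualForm_three]
    exact ternaryForm_nonneg hr h₁ h₂ (hx a) (hx b) (hx c)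
  | succ n ih =>
    obtain ⟨i, hi, hmin⟩ := s.exists_min_image x (Finset.card_pos.1 (by omega))
    have hc := Finset.card_erase_of_mem hi
    exact (ih (s.erase i) (by omega) (by omega) (by omega)).trans
      (residualForm_powerSum_erase_le h₁ h₂ hi (hx i) hmin (by omega) hs₂)

end Nonnegativity

/-! ### The Lagrange polynomials in barycentric coordinates -/

section BarycentricFormulas

/-- The Lagrange polynomial of a node in the interior of a triangle, in terms of the barycentric
coordinates `a`, `b`, `c` of the vertices of the triangle; `r` stands for `√5`. -/
noncomputable def triangleValue (r a b c : ℝ) : ℝ :=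
  a * b * c * ((39 + 37 * r) * a + (107 - 35 * r) / 2 * (b + c) - (73 + r) / 2)

/-- A symmetric form in the barycentric coordinates other than `a` and `b`, with coefficients `l`,
`m`, `n`; here `u` is the sum of the squares of all barycentric coordinates. -/
noncomputable def edgeTail (l m n a b u : ℝ) : ℝ :=
  l * ((a + b) * (1 - a - b)) + m * (u - a ^ 2 - b ^ 2) +
    n * (((1 - a - b) ^ 2 - (u - a ^ 2 - b ^ 2)) / 2)

/-- The Lagrange polynomial of the midpoint of an edge, in terms of the barycentric coordinates `a`,
`b` of its ends and the sum `u` of the squares of all barycentric coordinates. -/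
noncomputable def midpointValue (r a b u : ℝ) : ℝ :=
  a * b * (-16 / 3 * (a ^ 2 + b ^ 2) + 80 / 3 * (a * b) +
    edgeTail (-200 / 11 + 136 / 33 * r) (632 / 33 - 72 / 11 * r) (608 / 33 - 112 / 33 * r) a b u)

/-- The part of the Lagrange polynomial of an outer edge node that is symmetric in the ends of the
edge. -/
noncomputable def outerEvenValue (r a b u : ℝ) : ℝ :=
  a * b * (49 / 6 * (a - b) ^ 2 +
    edgeTail (-147 / 44 - 245 / 132 * r) (49 / 66 + 49 / 22 * r) (392 / 33 + 98 / 33 * r) a b u)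

/-- The part of the Lagrange polynomial of an outer edge node that is antisymmetric in the ends of
the edge, up to a factor `√(3/7)`. -/
noncomputable def outerOddValue (r a b : ℝ) : ℝ :=
  a * b * (b - a) * (49 / 6 * (a + b) - (245 + 49 * r) / 12 * (1 - a - b))

/-- The Lagrange polynomial of an outer edge node; `q` stands for `√(3/7)`. -/
noncomputable def outerValue (r q a b u : ℝ) : ℝ :=
  outerEvenValue r a b u + q * outerOddValue r a b

/-- The Lagrange polynomial of a vertex,
    in terms of its barycentric coordinate `a` and the sums `u`,
`v` of the squares and cubes of all barycentric coordinates. -/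
noncomputable def vertexValue (r a u v : ℝ) : ℝ :=
  a * (a ^ 3 - 6 * a ^ 2 * (1 - a) + 6 * a * (u - a ^ 2) +
    (261 + 57 * r) / 22 * (a * (((1 - a) ^ 2 - (u - a ^ 2)) / 2)) - (v - a ^ 3) -
    (40 + 10 * r) / 11 * ((1 - a) * (u - a ^ 2) - (v - a ^ 3)) -
    (259 + 51 * r) / 22 *
      (((1 - a) ^ 3 - 3 * (1 - a) * (u - a ^ 2) + 2 * (v - a ^ 3)) / 6))

variable {ι : Type*} [DecidableEq ι]

theorem triangleValue_sq {r : ℝ} (hr : r ^ 2 = 5) (a b c : ℝ) :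
    triangleValue r a b c ^ 2 =
      ((2667/2 + 73/2 * r)) * (a ^ 2 * b ^ 2 * c ^ 2) +
      ((-3818 + 1224 * r)) * (a ^ 2 * b ^ 2 * c ^ 3) +
      ((8787/2 - 3745/2 * r)) * (a ^ 2 * b ^ 2 * c ^ 4) +
      ((-3818 + 1224 * r)) * (a ^ 2 * b ^ 3 * c ^ 2) +
      ((8787 - 3745 * r)) * (a ^ 2 * b ^ 3 * c ^ 3) +
      ((8787/2 - 3745/2 * r)) * (a ^ 2 * b ^ 4 * c ^ 2) +
      ((-3032 - 2740 * r)) * (a ^ 3 * b ^ 2 * c ^ 2) +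
      ((-2302 + 2594 * r)) * (a ^ 3 * b ^ 2 * c ^ 3) +
      ((-2302 + 2594 * r)) * (a ^ 3 * b ^ 3 * c ^ 2) +
      ((8366 + 2886 * r)) * (a ^ 4 * b ^ 2 * c ^ 2) := by
  simp only [triangleValue]
  -- The value is affine in `r`. The multiplier of `r ^ 2 = 5` is the square of its coefficient of
  -- `r`, and likewise in the next two lemmas.
  linear_combination (a * b * c * (37 * a - 35 / 2 * (b + c) - 1 / 2)) ^ 2 * hr

/-- The contribution of an ordered pair. Midpoints belong to unordered pairs, hence the factor 1/2.
For the outer nodes the cross term of the even and odd parts cancels between the two orders, which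
leaves `q ^ 2 = 3 / 7`. -/
theorem edgeValue_sq {r : ℝ} (hr : r ^ 2 = 5) (a b u : ℝ) :
    midpointValue r a b u ^ 2 / 2 + outerEvenValue r a b u ^ 2 + 3 / 7 * outerOddValue r a b ^ 2 =
      ((34823/363 + 728/363 * r) + (9921/121 - 24737/363 * r) * u + (33379/242 - 40589/726 * r) *
          u ^ 2) * (a ^ 2 * b ^ 2) +
      ((-474391/726 + 20929/726 * r) + (-307579/726 + 67697/242 * r) * u) * (a ^ 2 * b ^ 3) +
      ((871735/484 + 5741/484 * r) + (-8722/121 - 7477/121 * r) * u) * (a ^ 2 * b ^ 4) +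
      ((-1355063/726 - 248695/726 * r)) * (a ^ 2 * b ^ 5) +
      ((487967/484 + 299065/1452 * r)) * (a ^ 2 * b ^ 6) +
      ((-474391/726 + 20929/726 * r) + (-307579/726 + 67697/242 * r) * u) * (a ^ 3 * b ^ 2) +
      ((1039840/363 - 202832/363 * r) + (405892/363 - 209354/363 * r) * u) * (a ^ 3 * b ^ 3) +
      ((-3290497/726 + 590719/726 * r)) * (a ^ 3 * b ^ 4) +
      ((957043/726 + 68351/726 * r)) * (a ^ 3 * b ^ 5) +
      ((871735/484 + 5741/484 * r) + (-8722/121 - 7477/121 * r) * u) * (a ^ 4 * b ^ 2) +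
      ((-3290497/726 + 590719/726 * r)) * (a ^ 4 * b ^ 3) +
      ((1054399/242 - 219325/242 * r)) * (a ^ 4 * b ^ 4) +
      ((-1355063/726 - 248695/726 * r)) * (a ^ 5 * b ^ 2) +
      ((957043/726 + 68351/726 * r)) * (a ^ 5 * b ^ 3) +
      ((487967/484 + 299065/1452 * r)) * (a ^ 6 * b ^ 2) := by
  simp only [midpointValue, outerEvenValue, outerOddValue, edgeTail]
  linear_combination ((a * b * (136 / 33 * ((a + b) * (1 - a - b)) -
      72 / 11 * (u - a ^ 2 - b ^ 2) -
      112 / 33 * (((1 - a - b) ^ 2 - (u - a ^ 2 - b ^ 2)) / 2))) ^ 2 / 2 +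
    (a * b * (-245 / 132 * ((a + b) * (1 - a - b)) + 49 / 22 * (u - a ^ 2 - b ^ 2) +
      98 / 33 * (((1 - a - b) ^ 2 - (u - a ^ 2 - b ^ 2)) / 2))) ^ 2 +
    3 / 7 * (a * b * (b - a) * (49 / 12 * (1 - a - b))) ^ 2) * hr

theorem vertexValue_sq {r : ℝ} (hr : r ^ 2 = 5) (a u v : ℝ) :
    vertexValue r a u v ^ 2 =
      ((40043/8712 + 4403/2904 * r) + (4930/1089 + 167/363 * r) * v + (3815/2178 - 85/242 * r) *
          v ^ 2 + (-431/44 - 359/132 * r) * u + (-60/11 - 1/33 * r) * u * v + (43/8 + 9/8 * r) *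
              u ^ 2) * a ^ 2 +
      ((-40555/726 - 4541/242 * r) + (-9835/363 - 375/121 * r) * v + (8936/121 + 8968/363 * r) *
          u + (425/121 + 1229/363 * r) * u * v + (-301/22 - 177/22 * r) * u ^ 2) * a ^ 3 +
      ((104282/363 + 34051/363 * r) + (2030/33 + 106/33 * r) * v + (-26197/121 - 9467/121 * r) *
          u + (2021/121 + 816/121 * r) * u ^ 2) * a ^ 4 +
      ((-289214/363 - 90206/363 * r) + (-15640/363 - 1072/363 * r) * v + (2922/11 + 1330/11 * r) *
          u) * a ^ 5 +
      ((153176/121 + 44916/121 * r) + (-15476/121 - 8500/121 * r) * u) * a ^ 6 +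
      ((-11864/11 - 3384/11 * r)) * a ^ 7 + ((46584/121 + 13736/121 * r)) * a ^ 8 := by
  simp only [vertexValue]
  linear_combination (a * (57 / 22 * (a * (((1 - a) ^ 2 - (u - a ^ 2)) / 2)) -
    10 / 11 * ((1 - a) * (u - a ^ 2) - (v - a ^ 3)) -
    51 / 22 * (((1 - a) ^ 3 - 3 * (1 - a) * (u - a ^ 2) + 2 * (v - a ^ 3)) / 6))) ^ 2 * hr

theorem sum_triangleValue_sq {r : ℝ} (hr : r ^ 2 = 5) (x : ι → ℝ) (s : Finset ι) :
    ∑ i ∈ s, ∑ j ∈ s.erase i, ∑ k ∈ (s.erase i).erase j, triangleValue r (x i) (x j) (x k) ^ 2 =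
      ((2667/2 + 73/2 * r)) * distinctSum x [2, 2, 2] s +
      ((-3818 + 1224 * r)) * distinctSum x [2, 2, 3] s +
      ((8787/2 - 3745/2 * r)) * distinctSum x [2, 2, 4] s +
      ((-3818 + 1224 * r)) * distinctSum x [2, 3, 2] s +
      ((8787 - 3745 * r)) * distinctSum x [2, 3, 3] s +
      ((8787/2 - 3745/2 * r)) * distinctSum x [2, 4, 2] s +
      ((-3032 - 2740 * r)) * distinctSum x [3, 2, 2] s +
      ((-2302 + 2594 * r)) * distinctSum x [3, 2, 3] s +
      ((-2302 + 2594 * r)) * distinctSum x [3, 3, 2] s +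
      ((8366 + 2886 * r)) * distinctSum x [4, 2, 2] s := by
  simp only [triangleValue_sq hr, distinctSum, Finset.mul_sum, ← Finset.sum_add_distrib, mul_one]
  refine Finset.sum_congr rfl fun i _ => Finset.sum_congr rfl fun j _ =>
    Finset.sum_congr rfl fun k _ => ?_
  ring

theorem sum_edgeValue_sq {r : ℝ} (hr : r ^ 2 = 5) (x : ι → ℝ) (s : Finset ι) (u : ℝ) :
    ∑ i ∈ s, ∑ j ∈ s.erase i, (midpointValue r (x i) (x j) u ^ 2 / 2 +
        outerEvenValue r (x i) (x j) u ^ 2 + 3 / 7 * outerOddValue r (x i) (x j) ^ 2) =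
      ((34823/363 + 728/363 * r) + (9921/121 - 24737/363 * r) * u + (33379/242 - 40589/726 * r) *
          u ^ 2) * distinctSum x [2, 2] s +
      ((-474391/726 + 20929/726 * r) + (-307579/726 + 67697/242 * r) * u) * distinctSum x [2, 3] s +
      ((871735/484 + 5741/484 * r) + (-8722/121 - 7477/121 * r) * u) * distinctSum x [2, 4] s +
      ((-1355063/726 - 248695/726 * r)) * distinctSum x [2, 5] s +
      ((487967/484 + 299065/1452 * r)) * distinctSum x [2, 6] s +
      ((-474391/726 + 20929/726 * r) + (-307579/726 + 67697/242 * r) * u) * distinctSum x [3, 2] s +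
      ((1039840/363 - 202832/363 * r) + (405892/363 - 209354/363 * r) * u) * distinctSum x [3,
          3] s +
      ((-3290497/726 + 590719/726 * r)) * distinctSum x [3, 4] s +
      ((957043/726 + 68351/726 * r)) * distinctSum x [3, 5] s +
      ((871735/484 + 5741/484 * r) + (-8722/121 - 7477/121 * r) * u) * distinctSum x [4, 2] s +
      ((-3290497/726 + 590719/726 * r)) * distinctSum x [4, 3] s +
      ((1054399/242 - 219325/242 * r)) * distinctSum x [4, 4] s +
      ((-1355063/726 - 248695/726 * r)) * distinctSum x [5, 2] s +
      ((957043/726 + 68351/726 * r)) * distinctSum x [5, 3] s +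
      ((487967/484 + 299065/1452 * r)) * distinctSum x [6, 2] s := by
  simp only [edgeValue_sq hr, distinctSum, Finset.mul_sum, ← Finset.sum_add_distrib, mul_one]

omit [DecidableEq ι] in
theorem sum_vertexValue_sq {r : ℝ} (hr : r ^ 2 = 5) (x : ι → ℝ) (s : Finset ι) (u v : ℝ) :
    ∑ i ∈ s, vertexValue r (x i) u v ^ 2 =
      ((40043/8712 + 4403/2904 * r) + (4930/1089 + 167/363 * r) * v + (3815/2178 - 85/242 * r) *
          v ^ 2 + (-431/44 - 359/132 * r) * u + (-60/11 - 1/33 * r) * u * v + (43/8 + 9/8 * r) *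
              u ^ 2) * powerSum x s 2 +
      ((-40555/726 - 4541/242 * r) + (-9835/363 - 375/121 * r) * v + (8936/121 + 8968/363 * r) *
          u + (425/121 + 1229/363 * r) * u * v + (-301/22 - 177/22 * r) * u ^ 2) * powerSum x s 3 +
      ((104282/363 + 34051/363 * r) + (2030/33 + 106/33 * r) * v + (-26197/121 - 9467/121 * r) *
          u + (2021/121 + 816/121 * r) * u ^ 2) * powerSum x s 4 +
      ((-289214/363 - 90206/363 * r) + (-15640/363 - 1072/363 * r) * v + (2922/11 + 1330/11 * r) *
          u) * powerSum x s 5 +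
      ((153176/121 + 44916/121 * r) + (-15476/121 - 8500/121 * r) * u) * powerSum x s 6 +
      ((-11864/11 - 3384/11 * r)) * powerSum x s 7 + ((46584/121 + 13736/121 * r)) *
          powerSum x s 8 := by
  simp only [vertexValue_sq hr, powerSum, Finset.mul_sum, ← Finset.sum_add_distrib]

/-- The squares expand into distinct sums, and these into power sums. The powers of `p 1` in
`residualForm` only make it homogeneous, so they disappear when the variables sum to 1. -/
theorem sum_sq_eq_one_sub_residualForm {r : ℝ} (hr : r ^ 2 = 5) (x : ι → ℝ) (s : Finset ι)
    (hx : powerSum x s 1 = 1) :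
    (∑ i ∈ s, ∑ j ∈ s.erase i, ∑ k ∈ (s.erase i).erase j,
        triangleValue r (x i) (x j) (x k) ^ 2) / 2 +
      ∑ i ∈ s, ∑ j ∈ s.erase i, (midpointValue r (x i) (x j) (powerSum x s 2) ^ 2 / 2 +
        outerEvenValue r (x i) (x j) (powerSum x s 2) ^ 2 +
        3 / 7 * outerOddValue r (x i) (x j) ^ 2) +
      ∑ i ∈ s, vertexValue r (x i) (powerSum x s 2) (powerSum x s 3) ^ 2 =
    1 - residualForm r (powerSum x s) := by
  rw [sum_triangleValue_sq hr, sum_edgeValue_sq hr, sum_vertexValue_sq hr]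
  simp only [distinctSum_cons, distinctSum_nil, pickings, mergedSum_mk, List.map_cons,
    List.map_nil, List.sum_cons, List.sum_nil, Nat.reduceAdd, residualForm, hx]
  ring

end BarycentricFormulas

/-! ### The nodes and the values of the Lagrange polynomials at the nodes -/

section NodeValues

theorem triangleValue_self {r : ℝ} (hr : r ^ 2 = 5) :
    triangleValue r ((4 + r) / 11) ((7 - r) / 22) ((7 - r) / 22) = 1 := by
  simp only [triangleValue]
  grind

theorem triangleValue_second {r : ℝ} (hr : r ^ 2 = 5) :
    triangleValue r ((7 - r) / 22) ((4 + r) / 11) ((7 - r) / 22) = 0 := by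
  simp only [triangleValue]
  grind

theorem triangleValue_third {r : ℝ} (hr : r ^ 2 = 5) :
    triangleValue r ((7 - r) / 22) ((7 - r) / 22) ((4 + r) / 11) = 0 := by
  simp only [triangleValue]
  grind

theorem triangleValue_centroid (r : ℝ) : triangleValue r (1 / 4) (1 / 4) (1 / 4) = 0 := by
  simp only [triangleValue]
  ring

theorem triangleValue_eq_zero (r : ℝ) {a b c : ℝ} (h : a = 0 ∨ b = 0 ∨ c = 0) :
    triangleValue r a b c = 0 := by
  simp only [triangleValue]
  rcases h with rfl | rfl | rfl <;> ring

theorem midpointValue_triangle {r : ℝ} (hr : r ^ 2 = 5) {a b u : ℝ}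
    (h : a = (4 + r) / 11 ∧ b = (7 - r) / 22 ∨ a = (7 - r) / 22 ∧ b = (4 + r) / 11 ∨
      a = (7 - r) / 22 ∧ b = (7 - r) / 22)
    (hu : u = ((4 + r) / 11) ^ 2 + ((7 - r) / 22) ^ 2 + ((7 - r) / 22) ^ 2) :
    midpointValue r a b u = 0 := by
  subst hu
  simp only [midpointValue, edgeTail]
  rcases h with ⟨rfl, rfl⟩ | ⟨rfl, rfl⟩ | ⟨rfl, rfl⟩ <;> grind

theorem outerEvenValue_triangle {r : ℝ} (hr : r ^ 2 = 5) {a b u : ℝ}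
    (h : a = (4 + r) / 11 ∧ b = (7 - r) / 22 ∨ a = (7 - r) / 22 ∧ b = (4 + r) / 11 ∨
      a = (7 - r) / 22 ∧ b = (7 - r) / 22)
    (hu : u = ((4 + r) / 11) ^ 2 + ((7 - r) / 22) ^ 2 + ((7 - r) / 22) ^ 2) :
    outerEvenValue r a b u = 0 := by
  subst hu
  simp only [outerEvenValue, edgeTail]
  rcases h with ⟨rfl, rfl⟩ | ⟨rfl, rfl⟩ | ⟨rfl, rfl⟩ <;> grind

theorem outerOddValue_triangle {r : ℝ} (hr : r ^ 2 = 5) {a b : ℝ}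
    (h : a = (4 + r) / 11 ∧ b = (7 - r) / 22 ∨ a = (7 - r) / 22 ∧ b = (4 + r) / 11 ∨
      a = (7 - r) / 22 ∧ b = (7 - r) / 22) :
    outerOddValue r a b = 0 := by
  simp only [outerOddValue]
  rcases h with ⟨rfl, rfl⟩ | ⟨rfl, rfl⟩ | ⟨rfl, rfl⟩ <;> grind

theorem vertexValue_triangle {r : ℝ} (hr : r ^ 2 = 5) {a u v : ℝ}
    (h : a = (4 + r) / 11 ∨ a = (7 - r) / 22)
    (hu : u = ((4 + r) / 11) ^ 2 + ((7 - r) / 22) ^ 2 + ((7 - r) / 22) ^ 2)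
    (hv : v = ((4 + r) / 11) ^ 3 + ((7 - r) / 22) ^ 3 + ((7 - r) / 22) ^ 3) :
    vertexValue r a u v = 0 := by
  subst hu hv
  simp only [vertexValue]
  rcases h with rfl | rfl <;> grind

theorem midpointValue_eq_zero (r : ℝ) {a b : ℝ} (u : ℝ) (h : a = 0 ∨ b = 0) :
    midpointValue r a b u = 0 := by
  simp only [midpointValue]
  rcases h with rfl | rfl <;> ring

theorem outerValue_eq_zero (r q : ℝ) {a b : ℝ} (u : ℝ) (h : a = 0 ∨ b = 0) :
    outerValue r q a b u = 0 := by
  simp only [outerValue, outerEvenValue, outerOddValue]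
  rcases h with rfl | rfl <;> ring

theorem vertexValue_zero (r u v : ℝ) : vertexValue r 0 u v = 0 := by
  simp only [vertexValue]
  ring

theorem midpointValue_centroid (r : ℝ) : midpointValue r (1 / 4) (1 / 4) (1 / 4) = 0 := by
  simp only [midpointValue, edgeTail]
  ring

theorem outerValue_centroid (r q : ℝ) : outerValue r q (1 / 4) (1 / 4) (1 / 4) = 0 := by
  simp only [outerValue, outerEvenValue, outerOddValue, edgeTail]
  ring

theorem vertexValue_centroid (r : ℝ) : vertexValue r (1 / 4) (1 / 4) (1 / 16) = 0 := by
  simp only [vertexValue]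
  ring

theorem midpointValue_outer (r : ℝ) {q a b u : ℝ} (hq : q ^ 2 = 3 / 7)
    (h : a = (1 - q) / 2 ∧ b = (1 + q) / 2 ∨ a = (1 + q) / 2 ∧ b = (1 - q) / 2)
    (hu : u = a ^ 2 + b ^ 2) : midpointValue r a b u = 0 := by
  subst hu
  simp only [midpointValue, edgeTail]
  rcases h with ⟨rfl, rfl⟩ | ⟨rfl, rfl⟩ <;> grind

theorem outerValue_self (r : ℝ) {q u : ℝ} (hq : q ^ 2 = 3 / 7)
    (hu : u = ((1 - q) / 2) ^ 2 + ((1 + q) / 2) ^ 2) :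
    outerValue r q ((1 - q) / 2) ((1 + q) / 2) u = 1 := by
  subst hu
  simp only [outerValue, outerEvenValue, outerOddValue, edgeTail]
  grind

theorem outerValue_swap (r : ℝ) {q u : ℝ}
    (hu : u = ((1 - q) / 2) ^ 2 + ((1 + q) / 2) ^ 2) :
    outerValue r q ((1 + q) / 2) ((1 - q) / 2) u = 0 := by
  subst hu
  simp only [outerValue, outerEvenValue, outerOddValue, edgeTail]
  grind

theorem vertexValue_outer (r : ℝ) {q a u v : ℝ} (hq : q ^ 2 = 3 / 7)
    (h : a = (1 - q) / 2 ∨ a = (1 + q) / 2)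
    (hu : u = ((1 - q) / 2) ^ 2 + ((1 + q) / 2) ^ 2)
    (hv : v = ((1 - q) / 2) ^ 3 + ((1 + q) / 2) ^ 3) : vertexValue r a u v = 0 := by
  subst hu hv
  simp only [vertexValue]
  rcases h with rfl | rfl <;> grind

theorem midpointValue_self (r : ℝ) : midpointValue r (1 / 2) (1 / 2) (1 / 2) = 1 := by
  simp only [midpointValue, edgeTail]
  ring

theorem outerValue_midpoint (r q : ℝ) : outerValue r q (1 / 2) (1 / 2) (1 / 2) = 0 := by
  simp only [outerValue, outerEvenValue, outerOddValue, edgeTail]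
  ring

theorem vertexValue_midpoint (r : ℝ) : vertexValue r (1 / 2) (1 / 2) (1 / 4) = 0 := by
  simp only [vertexValue]
  ring

theorem vertexValue_self (r : ℝ) : vertexValue r 1 1 1 = 1 := by
  simp only [vertexValue]
  ring

end NodeValues

/-! ### Nodes as combinatorial labels and their barycentric coordinates. -/

section Nodes

variable {ι : Type*}

section PowerSums

variable [DecidableEq ι] [Fintype ι]

/-- Exponent 0 is excluded because `0 ^ 0 = 1` would count the zero entries. -/
theorem powerSum_single (i : ι) (a : ℝ) {k : ℕ} (hk : k ≠ 0) :
    powerSum (Pi.single i a) Finset.univ k = a ^ k := by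
  rw [powerSum, Finset.sum_eq_single i]
  · simp
  · intro j _ hj
    simp [Pi.single_eq_of_ne hj, hk]
  · simp

theorem powerSum_add_single {f : ι → ℝ} {i : ι} (hf : f i = 0) (a : ℝ) {k : ℕ} (hk : k ≠ 0) :
    powerSum (f + Pi.single i a) Finset.univ k = powerSum f Finset.univ k + a ^ k := by
  rw [← powerSum_single i a hk, powerSum, powerSum, powerSum, ← Finset.sum_add_distrib]
  refine Finset.sum_congr rfl fun j _ => ?_
  rcases eq_or_ne j i with rfl | hj
  · simp [hf, hk]
  · simp [Pi.single_eq_of_ne hj, hk]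

end PowerSums

variable [LinearOrder ι]

/-- The nodes of degree four of a simplex, in terms of its vertices. -/
inductive Node (ι : Type*) [LinearOrder ι]
  | centroid (i j k l : ι) (h : i < j ∧ j < k ∧ k < l)
  | triangle (i j k : ι) (h : i ≠ j ∧ i ≠ k ∧ j < k)
  | outer (i j : ι) (h : i ≠ j)
  | midpoint (i j : ι) (h : i < j)
  | vertex (i : ι)

/-- The barycentric coordinates of a node; `r` and `q` stand for `√5` and `√(3/7)`. -/
noncomputable def Node.weight (r q : ℝ) : Node ι → ι → ℝ
  | centroid i j k l _ =>
    Pi.single i (1 / 4) + Pi.single j (1 / 4) + Pi.single k (1 / 4) + Pi.single l (1 / 4)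
  | triangle i j k _ =>
    Pi.single i ((4 + r) / 11) + Pi.single j ((7 - r) / 22) + Pi.single k ((7 - r) / 22)
  | outer i j _ => Pi.single i ((1 - q) / 2) + Pi.single j ((1 + q) / 2)
  | midpoint i j _ => Pi.single i (1 / 2) + Pi.single j (1 / 2)
  | vertex i => Pi.single i 1

/-- The Lagrange polynomial of a node, as a function of the barycentric coordinates. -/
noncomputable def Node.value [Fintype ι] (r q : ℝ) (a : Node ι) (x : ι → ℝ) : ℝ :=
  match a with
  | centroid i j k l _ => 256 * x i * x j * x k * x l
  | triangle i j k _ => triangleValue r (x i) (x j) (x k)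
  | outer i j _ => outerValue r q (x i) (x j) (powerSum x Finset.univ 2)
  | midpoint i j _ => midpointValue r (x i) (x j) (powerSum x Finset.univ 2)
  | vertex i => vertexValue r (x i) (powerSum x Finset.univ 2) (powerSum x Finset.univ 3)

section Weights

variable {r q : ℝ}

theorem Node.weight_centroid_cases {i j k l : ι} (h : i < j ∧ j < k ∧ k < l) (m : ι) :
    (m = i ∨ m = j ∨ m = k ∨ m = l) ∧ (centroid i j k l h).weight r q m = 1 / 4 ∨
      (centroid i j k l h).weight r q m = 0 := by
  obtain ⟨h1, h2, h3⟩ := h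
  have h4 := h1.trans h2
  have h5 := h2.trans h3
  have h6 := h1.trans h5
  by_cases e1 : m = i
  · subst e1
    simp [weight, h1.ne, h4.ne, h6.ne]
  by_cases e2 : m = j
  · subst e2
    simp [weight, h1.ne', h2.ne, h5.ne]
  by_cases e3 : m = k
  · subst e3
    simp [weight, h4.ne', h2.ne', h3.ne]
  by_cases e4 : m = l
  · subst e4
    simp [weight, h6.ne', h5.ne', h3.ne']
  · simp [weight, e1, e2, e3, e4]

theorem Node.weight_triangle_cases {i j k : ι} (h : i ≠ j ∧ i ≠ k ∧ j < k) (m : ι) :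
    m = i ∧ (triangle i j k h).weight r q m = (4 + r) / 11 ∨
      m = j ∧ (triangle i j k h).weight r q m = (7 - r) / 22 ∨
      m = k ∧ (triangle i j k h).weight r q m = (7 - r) / 22 ∨
      (triangle i j k h).weight r q m = 0 := by
  obtain ⟨h1, h2, h3⟩ := h
  by_cases e1 : m = i
  · subst e1
    simp [weight, h1, h2]
  by_cases e2 : m = j
  · subst e2
    simp [weight, h1.symm, h3.ne]
  by_cases e3 : m = k
  · subst e3
    simp [weight, h2.symm, h3.ne']
  · simp [weight, e1, e2, e3]

theorem Node.weight_outer_cases {i j : ι} (h : i ≠ j) (m : ι) :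
    m = i ∧ (outer i j h).weight r q m = (1 - q) / 2 ∨
      m = j ∧ (outer i j h).weight r q m = (1 + q) / 2 ∨ (outer i j h).weight r q m = 0 := by
  by_cases e1 : m = i
  · subst e1
    simp [weight, h]
  by_cases e2 : m = j
  · subst e2
    simp [weight, h.symm]
  · simp [weight, e1, e2]

theorem Node.weight_midpoint_cases {i j : ι} (h : i < j) (m : ι) :
    (m = i ∨ m = j) ∧ (midpoint i j h).weight r q m = 1 / 2 ∨
      (midpoint i j h).weight r q m = 0 := by
  by_cases e1 : m = i
  · subst e1
    simp [weight, h.ne]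
  by_cases e2 : m = j
  · subst e2
    simp [weight, h.ne']
  · simp [weight, e1, e2]

theorem Node.weight_vertex_cases (i m : ι) :
    m = i ∧ (vertex i).weight r q m = 1 ∨ (vertex i).weight r q m = 0 := by
  by_cases e1 : m = i
  · subst e1
    simp [weight]
  · simp [weight, e1]

variable [Fintype ι]

theorem Node.powerSum_weight_centroid {i j k l : ι} (h : i < j ∧ j < k ∧ k < l) {m : ℕ}
    (hm : m ≠ 0) : powerSum ((centroid i j k l h).weight r q) Finset.univ m =
      (1 / 4) ^ m + (1 / 4) ^ m + (1 / 4) ^ m + (1 / 4) ^ m := by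
  obtain ⟨h1, h2, h3⟩ := h
  have h4 := h1.trans h2
  have h5 := h2.trans h3
  have h6 := h1.trans h5
  rw [weight, powerSum_add_single _ _ hm, powerSum_add_single _ _ hm, powerSum_add_single _ _ hm,
    powerSum_single _ _ hm] <;>
  simp [h1.ne', h2.ne', h3.ne', h4.ne', h5.ne', h6.ne']

theorem Node.powerSum_weight_triangle {i j k : ι} (h : i ≠ j ∧ i ≠ k ∧ j < k) {m : ℕ}
    (hm : m ≠ 0) : powerSum ((triangle i j k h).weight r q) Finset.univ m =
      ((4 + r) / 11) ^ m + ((7 - r) / 22) ^ m + ((7 - r) / 22) ^ m := by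
  obtain ⟨h1, h2, h3⟩ := h
  rw [weight, powerSum_add_single _ _ hm, powerSum_add_single _ _ hm, powerSum_single _ _ hm] <;>
  simp [h1.symm, h2.symm, h3.ne']

theorem Node.powerSum_weight_outer {i j : ι} (h : i ≠ j) {m : ℕ} (hm : m ≠ 0) :
    powerSum ((outer i j h).weight r q) Finset.univ m = ((1 - q) / 2) ^ m + ((1 + q) / 2) ^ m := by
  rw [weight, powerSum_add_single _ _ hm, powerSum_single _ _ hm]
  simp [h.symm]

theorem Node.powerSum_weight_midpoint {i j : ι} (h : i < j) {m : ℕ} (hm : m ≠ 0) :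
    powerSum ((midpoint i j h).weight r q) Finset.univ m = (1 / 2) ^ m + (1 / 2) ^ m := by
  rw [weight, powerSum_add_single _ _ hm, powerSum_single _ _ hm]
  simp [h.ne']

theorem Node.powerSum_weight_vertex (i : ι) {m : ℕ} (hm : m ≠ 0) :
    powerSum ((vertex i).weight r q) Finset.univ m = 1 := by
  rw [weight, powerSum_single _ _ hm, one_pow]

theorem Node.powerSum_weight_one (a : Node ι) : powerSum (a.weight r q) Finset.univ 1 = 1 := by
  cases a with
  | centroid i j k l h => rw [powerSum_weight_centroid h one_ne_zero]; ring
  | triangle i j k h => rw [powerSum_weight_triangle h one_ne_zero]; ring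
  | outer i j h => rw [powerSum_weight_outer h one_ne_zero]; ring
  | midpoint i j h => rw [powerSum_weight_midpoint h one_ne_zero]; ring
  | vertex i => rw [powerSum_weight_vertex i one_ne_zero]

theorem Node.value_weight_self (hr : r ^ 2 = 5) (hq : q ^ 2 = 3 / 7) (a : Node ι) :
    a.value r q (a.weight r q) = 1 := by
  cases a with
  | centroid i j k l h =>
    obtain ⟨h1, h2, h3⟩ := h
    have h4 := h1.trans h2
    have h5 := h2.trans h3
    have h6 := h1.trans h5
    simp [value, weight, h1.ne', h2.ne', h3.ne', h4.ne', h5.ne', h6.ne', h1.ne,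
      h2.ne, h3.ne, h4.ne, h5.ne, h6.ne]
    norm_num
  | triangle i j k h =>
    obtain ⟨h1, h2, h3⟩ := h
    rw [value, ← triangleValue_self hr]
    congr 1 <;> simp [weight, h1, h2, h3.ne, h1.symm, h2.symm, h3.ne']
  | outer i j h =>
    rw [value, ← outerValue_self r hq (powerSum_weight_outer (r := r) h two_ne_zero)]
    congr 1 <;> simp [weight, h, h.symm]
  | midpoint i j h =>
    rw [value, powerSum_weight_midpoint h two_ne_zero,
      show ((1 : ℝ) / 2) ^ 2 + (1 / 2) ^ 2 = 1 / 2 by norm_num]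
    simpa [weight, h.ne, h.ne'] using midpointValue_self r
  | vertex i =>
    rw [value, powerSum_weight_vertex i two_ne_zero, powerSum_weight_vertex i three_ne_zero]
    simp [weight, vertexValue_self]

end Weights

end Nodes

/-! ### Vanishing of the Lagrange polynomials at the other nodes. -/

section NodeOrthogonality

variable {ι : Type*} [LinearOrder ι]

theorem eq_of_sorted_of_mem {i j k l i' j' k' l' : ι} (h : i < j ∧ j < k ∧ k < l)
    (h' : i' < j' ∧ j' < k' ∧ k' < l')
    (hi : i = i' ∨ i = j' ∨ i = k' ∨ i = l') (hj : j = i' ∨ j = j' ∨ j = k' ∨ j = l')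
    (hk : k = i' ∨ k = j' ∨ k = k' ∨ k = l') (hl : l = i' ∨ l = j' ∨ l = k' ∨ l = l') :
    i = i' ∧ j = j' ∧ k = k' ∧ l = l' := by
  grind

theorem not_sorted_of_mem_three {i j k l x y z : ι} (h : i < j ∧ j < k ∧ k < l)
    (hi : i = x ∨ i = y ∨ i = z) (hj : j = x ∨ j = y ∨ j = z)
    (hk : k = x ∨ k = y ∨ k = z) (hl : l = x ∨ l = y ∨ l = z) : False := by
  grind

variable [Fintype ι] {r q : ℝ}

/-- A nonzero value needs all four indices in the support of the node `b`. Only centroids have so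
large a support, and the ordering then forces the same quadruple. -/
theorem Node.value_centroid_weight_of_ne {i j k l : ι} (h : i < j ∧ j < k ∧ k < l) {b : Node ι}
    (hab : centroid i j k l h ≠ b) : (centroid i j k l h).value r q (b.weight r q) = 0 := by
  rw [value]
  by_contra hne
  simp only [mul_eq_zero, not_or] at hne
  obtain ⟨⟨⟨⟨-, hi⟩, hj⟩, hk⟩, hl⟩ := hne
  cases b with
  | centroid i' j' k' l' h' =>
    have H := fun m => (weight_centroid_cases (r := r) (q := q) h' m)
    obtain ⟨rfl, rfl, rfl, rfl⟩ := eq_of_sorted_of_mem h h'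
      ((H i).resolve_right hi).1 ((H j).resolve_right hj).1
      ((H k).resolve_right hk).1 ((H l).resolve_right hl).1
    exact hab rfl
  | triangle i' j' k' h' =>
    have H : ∀ m, (triangle i' j' k' h').weight r q m ≠ 0 → m = i' ∨ m = j' ∨ m = k' := by
      intro m hm
      have := weight_triangle_cases (r := r) (q := q) h' m
      tauto
    exact not_sorted_of_mem_three h (H i hi) (H j hj) (H k hk) (H l hl)
  | outer i' j' h' =>
    -- The repeated index pads a support of two to the three slots of `not_sorted_of_mem_three`.
    have H : ∀ m, (outer i' j' h').weight r q m ≠ 0 → m = i' ∨ m = j' ∨ m = j' := by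
      intro m hm
      have := weight_outer_cases (r := r) (q := q) h' m
      tauto
    exact not_sorted_of_mem_three h (H i hi) (H j hj) (H k hk) (H l hl)
  | midpoint i' j' h' =>
    have H : ∀ m, (midpoint i' j' h').weight r q m ≠ 0 → m = i' ∨ m = j' ∨ m = j' := by
      intro m hm
      have := weight_midpoint_cases (r := r) (q := q) h' m
      tauto
    exact not_sorted_of_mem_three h (H i hi) (H j hj) (H k hk) (H l hl)
  | vertex i' =>
    have H : ∀ m, (vertex i').weight r q m ≠ 0 → m = i' ∨ m = i' ∨ m = i' := by
      intro m hm
      have := weight_vertex_cases (r := r) (q := q) i' m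
      tauto
    exact not_sorted_of_mem_three h (H i hi) (H j hj) (H k hk) (H l hl)

/-- The factor `a * b * c` disposes of nodes whose support misses one of the three indices. The
linear factor vanishes at the centroids and at the other two nodes of the same triangle. -/
theorem Node.value_triangle_weight_of_ne (hr : r ^ 2 = 5) {i j k : ι}
    (h : i ≠ j ∧ i ≠ k ∧ j < k) {b : Node ι} (hab : triangle i j k h ≠ b) :
    (triangle i j k h).value r q (b.weight r q) = 0 := by
  rw [value]
  by_cases hi : b.weight r q i = 0
  · exact triangleValue_eq_zero r (Or.inl hi)
  by_cases hj : b.weight r q j = 0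
  · exact triangleValue_eq_zero r (Or.inr (Or.inl hj))
  by_cases hk : b.weight r q k = 0
  · exact triangleValue_eq_zero r (Or.inr (Or.inr hk))
  have hjk := h.2.2.ne
  cases b with
  | centroid i' j' k' l' h' =>
    have H := fun m => (weight_centroid_cases (r := r) (q := q) h' m)
    rw [((H i).resolve_right hi).2, ((H j).resolve_right hj).2, ((H k).resolve_right hk).2]
    exact triangleValue_centroid r
  | triangle i' j' k' h' =>
    have H := fun m => (weight_triangle_cases (r := r) (q := q) h' m)
    have hlt := h'.2.2
    rcases H i with ⟨ei, wi⟩ | ⟨ei, wi⟩ | ⟨ei, wi⟩ | wi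
    · exfalso
      obtain ⟨rfl, rfl, rfl⟩ : i = i' ∧ j = j' ∧ k = k' := by
        have h1 := H j
        have h2 := H k
        grind
      exact hab rfl
    · rcases H j with ⟨ej, wj⟩ | ⟨ej, wj⟩ | ⟨ej, wj⟩ | wj
      · rcases H k with ⟨ek, wk⟩ | ⟨ek, wk⟩ | ⟨ek, wk⟩ | wk
        · exact absurd (ej.trans ek.symm) hjk
        · rw [wi, wj, wk, triangleValue_second hr]
        · rw [wi, wj, wk, triangleValue_second hr]
        · exact absurd wk hk
      · exact absurd (ei.trans ej.symm) h.1
      · rcases H k with ⟨ek, wk⟩ | ⟨ek, wk⟩ | ⟨ek, wk⟩ | wk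
        · rw [wi, wj, wk, triangleValue_third hr]
        · exact absurd (ei.trans ek.symm) h.2.1
        · exact absurd (ej.trans ek.symm) hjk
        · exact absurd wk hk
      · exact absurd wj hj
    · rcases H j with ⟨ej, wj⟩ | ⟨ej, wj⟩ | ⟨ej, wj⟩ | wj
      · rcases H k with ⟨ek, wk⟩ | ⟨ek, wk⟩ | ⟨ek, wk⟩ | wk
        · exact absurd (ej.trans ek.symm) hjk
        · rw [wi, wj, wk, triangleValue_second hr]
        · rw [wi, wj, wk, triangleValue_second hr]
        · exact absurd wk hk
      · rcases H k with ⟨ek, wk⟩ | ⟨ek, wk⟩ | ⟨ek, wk⟩ | wk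
        · rw [wi, wj, wk, triangleValue_third hr]
        · exact absurd (ej.trans ek.symm) hjk
        · exact absurd (ei.trans ek.symm) h.2.1
        · exact absurd wk hk
      · exact absurd (ei.trans ej.symm) h.1
      · exact absurd wj hj
    · exact absurd wi hi
  | outer i' j' h' =>
    have H := fun m => (weight_outer_cases (r := r) (q := q) h' m)
    have h1 := H i
    have h2 := H j
    have h3 := H k
    grind
  | midpoint i' j' h' =>
    have H := fun m => (weight_midpoint_cases (r := r) (q := q) h' m)
    have h1 := H i
    have h2 := H j
    have h3 := H k
    grind
  | vertex i' =>
    have H := fun m => (weight_vertex_cases (r := r) (q := q) i' m)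
    have h1 := H i
    have h2 := H j
    grind

-- Only one vertex carries the weight `(4 + r) / 11`, so two distinct indices cannot both have it.
omit [Fintype ι] in
theorem Node.weight_triangle_pair {i j i' j' k' : ι} (hij : i ≠ j)
    (h' : i' ≠ j' ∧ i' ≠ k' ∧ j' < k') (hi : (triangle i' j' k' h').weight r q i ≠ 0)
    (hj : (triangle i' j' k' h').weight r q j ≠ 0) :
    (triangle i' j' k' h').weight r q i = (4 + r) / 11 ∧
        (triangle i' j' k' h').weight r q j = (7 - r) / 22 ∨
      (triangle i' j' k' h').weight r q i = (7 - r) / 22 ∧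
        (triangle i' j' k' h').weight r q j = (4 + r) / 11 ∨
      (triangle i' j' k' h').weight r q i = (7 - r) / 22 ∧
        (triangle i' j' k' h').weight r q j = (7 - r) / 22 := by
  have h1 := weight_triangle_cases (r := r) (q := q) h' i
  have h2 := weight_triangle_cases (r := r) (q := q) h' j
  have h3 : ¬ (i = i' ∧ j = i') := fun h => hij (h.1.trans h.2.symm)
  tauto

theorem Node.value_outer_weight_of_ne (hr : r ^ 2 = 5) {i j : ι}
    (h : i ≠ j) {b : Node ι} (hab : outer i j h ≠ b) :
    (outer i j h).value r q (b.weight r q) = 0 := by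
  rw [value]
  by_cases hi : b.weight r q i = 0
  · exact outerValue_eq_zero r q _ (Or.inl hi)
  by_cases hj : b.weight r q j = 0
  · exact outerValue_eq_zero r q _ (Or.inr hj)
  cases b with
  | centroid i' j' k' l' h' =>
    have H := fun m => (weight_centroid_cases (r := r) (q := q) h' m)
    rw [((H i).resolve_right hi).2, ((H j).resolve_right hj).2,
      powerSum_weight_centroid h' two_ne_zero, ← outerValue_centroid r q]
    norm_num
  | triangle i' j' k' h' =>
    have H := weight_triangle_pair h h' hi hj
    have hu := powerSum_weight_triangle (r := r) (q := q) h' two_ne_zero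
    rw [outerValue, outerEvenValue_triangle hr H hu, outerOddValue_triangle hr H, mul_zero,
      add_zero]
  | outer i' j' h' =>
    have H := fun m => (weight_outer_cases (r := r) (q := q) h' m)
    rcases H i with ⟨ei, wi⟩ | ⟨ei, wi⟩ | wi
    · rcases H j with ⟨ej, wj⟩ | ⟨ej, wj⟩ | wj
      · exact absurd (ei.trans ej.symm) h
      · subst ei ej
        exact absurd rfl hab
      · exact absurd wj hj
    · rcases H j with ⟨ej, wj⟩ | ⟨ej, wj⟩ | wj
      · rw [wi, wj]
        exact outerValue_swap r (powerSum_weight_outer h' two_ne_zero)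
      · exact absurd (ei.trans ej.symm) h
      · exact absurd wj hj
    · exact absurd wi hi
  | midpoint i' j' h' =>
    have H := fun m => (weight_midpoint_cases (r := r) (q := q) h' m)
    rw [((H i).resolve_right hi).2, ((H j).resolve_right hj).2,
      powerSum_weight_midpoint h' two_ne_zero, ← outerValue_midpoint r q]
    norm_num
  | vertex i' =>
    have H := fun m => (weight_vertex_cases (r := r) (q := q) i' m)
    exact absurd (((H i).resolve_right hi).1.trans ((H j).resolve_right hj).1.symm) h

theorem Node.value_midpoint_weight_of_ne (hr : r ^ 2 = 5) (hq : q ^ 2 = 3 / 7) {i j : ι}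
    (h : i < j) {b : Node ι} (hab : midpoint i j h ≠ b) :
    (midpoint i j h).value r q (b.weight r q) = 0 := by
  rw [value]
  by_cases hi : b.weight r q i = 0
  · exact midpointValue_eq_zero r _ (Or.inl hi)
  by_cases hj : b.weight r q j = 0
  · exact midpointValue_eq_zero r _ (Or.inr hj)
  cases b with
  | centroid i' j' k' l' h' =>
    have H := fun m => (weight_centroid_cases (r := r) (q := q) h' m)
    rw [((H i).resolve_right hi).2, ((H j).resolve_right hj).2,
      powerSum_weight_centroid h' two_ne_zero, ← midpointValue_centroid r]
    norm_num
  | triangle i' j' k' h' =>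
    exact midpointValue_triangle hr (weight_triangle_pair h.ne h' hi hj)
      (powerSum_weight_triangle (r := r) (q := q) h' two_ne_zero)
  | outer i' j' h' =>
    have H := fun m => (weight_outer_cases (r := r) (q := q) h' m)
    have hu := powerSum_weight_outer (r := r) (q := q) h' two_ne_zero
    rcases H i with ⟨ei, wi⟩ | ⟨ei, wi⟩ | wi
    · rcases H j with ⟨ej, wj⟩ | ⟨ej, wj⟩ | wj
      · exact absurd (ei.trans ej.symm) h.ne
      · exact midpointValue_outer r hq (Or.inl ⟨wi, wj⟩) (by rw [wi, wj, hu])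
      · exact absurd wj hj
    · rcases H j with ⟨ej, wj⟩ | ⟨ej, wj⟩ | wj
      · exact midpointValue_outer r hq (Or.inr ⟨wi, wj⟩) (by rw [wi, wj, hu, add_comm])
      · exact absurd (ei.trans ej.symm) h.ne
      · exact absurd wj hj
    · exact absurd wi hi
  | midpoint i' j' h' =>
    have H := fun m => (weight_midpoint_cases (r := r) (q := q) h' m)
    have h1 := ((H i).resolve_right hi).1
    have h2 := ((H j).resolve_right hj).1
    obtain ⟨rfl, rfl⟩ : i = i' ∧ j = j' := by grind
    exact absurd rfl hab
  | vertex i' =>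
    have H := fun m => (weight_vertex_cases (r := r) (q := q) i' m)
    exact absurd (((H i).resolve_right hi).1.trans ((H j).resolve_right hj).1.symm) h.ne

theorem Node.value_vertex_weight_of_ne (hr : r ^ 2 = 5) (hq : q ^ 2 = 3 / 7) {i : ι}
    {b : Node ι} (hab : vertex i ≠ b) : (vertex i).value r q (b.weight r q) = 0 := by
  rw [value]
  by_cases hi : b.weight r q i = 0
  · rw [hi, vertexValue_zero]
  cases b with
  | centroid i' j' k' l' h' =>
    rw [((weight_centroid_cases h' i).resolve_right hi).2,
      powerSum_weight_centroid h' two_ne_zero, powerSum_weight_centroid h' three_ne_zero,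
      ← vertexValue_centroid r]
    norm_num
  | triangle i' j' k' h' =>
    refine vertexValue_triangle hr ?_ (powerSum_weight_triangle (r := r) (q := q) h' two_ne_zero)
      (powerSum_weight_triangle (r := r) (q := q) h' three_ne_zero)
    have := weight_triangle_cases (r := r) (q := q) h' i
    tauto
  | outer i' j' h' =>
    refine vertexValue_outer r hq ?_ (powerSum_weight_outer (r := r) (q := q) h' two_ne_zero)
      (powerSum_weight_outer (r := r) (q := q) h' three_ne_zero)
    have := weight_outer_cases (r := r) (q := q) h' i
    tauto
  | midpoint i' j' h' =>
    rw [((weight_midpoint_cases h' i).resolve_right hi).2,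
      powerSum_weight_midpoint h' two_ne_zero, powerSum_weight_midpoint h' three_ne_zero,
      ← vertexValue_midpoint r]
    norm_num
  | vertex i' =>
    obtain rfl := ((weight_vertex_cases i' i).resolve_right hi).1
    exact absurd rfl hab

theorem Node.value_weight_of_ne (hr : r ^ 2 = 5) (hq : q ^ 2 = 3 / 7) {a b : Node ι}
    (hab : a ≠ b) : a.value r q (b.weight r q) = 0 := by
  cases a with
  | centroid i j k l h => exact value_centroid_weight_of_ne h hab
  | triangle i j k h => exact value_triangle_weight_of_ne hr h hab
  | outer i j h => exact value_outer_weight_of_ne hr h hab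
  | midpoint i j h => exact value_midpoint_weight_of_ne hr hq h hab
  | vertex i => exact value_vertex_weight_of_ne hr hq hab

end NodeOrthogonality

/-! ### Polynomial functions -/

section PolynomialFunctions

variable {σ : Type*}

/-- `f` is a polynomial function of degree at most `k`. -/
def IsPolynomialFunction (k : ℕ) (f : (σ → ℝ) → ℝ) : Prop :=
  ∃ p : MvPolynomial σ ℝ, p.totalDegree ≤ k ∧ ∀ x, MvPolynomial.eval x p = f x

namespace IsPolynomialFunction

variable {k l : ℕ} {f g : (σ → ℝ) → ℝ}

theorem const (k : ℕ) (c : ℝ) : IsPolynomialFunction k fun _ : σ → ℝ => c :=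
  ⟨MvPolynomial.C c, by simp, by simp⟩

theorem apply (i : σ) : IsPolynomialFunction 1 fun x : σ → ℝ => x i :=
  ⟨MvPolynomial.X i, by simp, by simp⟩

theorem add (hf : IsPolynomialFunction k f) (hg : IsPolynomialFunction k g) :
    IsPolynomialFunction k fun x => f x + g x := by
  obtain ⟨p, hp, hpf⟩ := hf
  obtain ⟨q, hq, hqg⟩ := hg
  exact ⟨p + q, (MvPolynomial.totalDegree_add p q).trans (max_le hp hq), by simp [hpf, hqg]⟩

theorem mul (hf : IsPolynomialFunction k f) (hg : IsPolynomialFunction l g) :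
    IsPolynomialFunction (k + l) fun x => f x * g x := by
  obtain ⟨p, hp, hpf⟩ := hf
  obtain ⟨q, hq, hqg⟩ := hg
  exact ⟨p * q, (MvPolynomial.totalDegree_mul p q).trans (add_le_add hp hq), by simp [hpf, hqg]⟩

theorem const_mul (hf : IsPolynomialFunction k f) (c : ℝ) :
    IsPolynomialFunction k fun x => c * f x := by
  simpa using (const 0 c).mul hf

theorem sub (hf : IsPolynomialFunction k f) (hg : IsPolynomialFunction k g) :
    IsPolynomialFunction k fun x => f x - g x := by
  simpa [sub_eq_add_neg] using hf.add (hg.const_mul (-1))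

theorem div_const (hf : IsPolynomialFunction k f) (c : ℝ) :
    IsPolynomialFunction k fun x => f x / c := by
  simpa [div_eq_inv_mul] using hf.const_mul c⁻¹

theorem pow (hf : IsPolynomialFunction k f) (m : ℕ) :
    IsPolynomialFunction (m * k) fun x => f x ^ m := by
  induction m with
  | zero => simpa using const (σ := σ) 0 1
  | succ m ih => simpa [pow_succ, add_mul] using ih.mul hf

theorem sum {ι : Type*} {s : Finset ι} {F : ι → (σ → ℝ) → ℝ}
    (h : ∀ i ∈ s, IsPolynomialFunction k (F i)) :
    IsPolynomialFunction k fun x => ∑ i ∈ s, F i x := by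
  classical
  induction s using Finset.induction_on with
  | empty => simpa using const (σ := σ) k 0
  | insert i s hi ih =>
    simp only [Finset.sum_insert hi]
    exact (h i (Finset.mem_insert_self i s)).add
      (ih fun j hj => h j (Finset.mem_insert_of_mem hj))

theorem affineMap [Fintype σ] (g : (σ → ℝ) →ᵃ[ℝ] ℝ) : IsPolynomialFunction 1 g := by
  classical
  have h : (g : (σ → ℝ) → ℝ) = fun x =>
      (∑ i, g.linear (fun j => if i = j then 1 else 0) * x i) + g 0 := by
    funext x
    have hg := congrFun g.decomp x
    rw [Pi.add_apply, LinearMap.pi_apply_eq_sum_univ g.linear x] at hg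
    simpa [mul_comm] using hg
  rw [h]
  exact (sum fun i _ => (apply i).const_mul _).add (const 1 _)

/-- If the constant function `1` and the coordinate functions lie in a space `W` of functions, then
the polynomial functions of degree at most `k` lie in `W ^ k`. -/
theorem mem_pow {W : Submodule ℝ ((σ → ℝ) → ℝ)} (h₁ : 1 ∈ W) (hW : ∀ i : σ, (fun x => x i) ∈ W)
    (hf : IsPolynomialFunction k f) : f ∈ W ^ k := by
  classical
  obtain ⟨p, hp, hpf⟩ := hf
  have hsum : f = ∑ s ∈ p.support, p.coeff s • ∏ i ∈ s.support, (fun x : σ → ℝ => x i) ^ s i := by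
    funext x
    simp [← hpf, MvPolynomial.eval_eq]
  rw [hsum]
  refine Submodule.sum_mem _ fun s hs => Submodule.smul_mem _ _ ?_
  have hprod : ∀ t : Finset σ,
      ∏ i ∈ t, (fun x : σ → ℝ => x i) ^ s i ∈ W ^ ∑ i ∈ t, s i := by
    intro t
    induction t using Finset.induction_on with
    | empty => simp
    | insert i t hi ih =>
      rw [Finset.prod_insert hi, Finset.sum_insert hi, pow_add]
      exact Submodule.mul_mem_mul (Submodule.pow_mem_pow W (hW i) (s i)) ih
  have hle : ∑ i ∈ s.support, s i ≤ k := (MvPolynomial.le_totalDegree hs).trans hp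
  -- A monomial of degree below `k` is padded by factors `1 ∈ W` to a product of exactly `k`
  -- elements.
  obtain ⟨m, hm⟩ := Nat.exists_eq_add_of_le hle
  rw [hm, pow_add, ← mul_one (∏ i ∈ s.support, _)]
  refine Submodule.mul_mem_mul (hprod _) ?_
  simpa using Submodule.pow_mem_pow W h₁ m

end IsPolynomialFunction

end PolynomialFunctions

/-! ### Quartic monomials indexed by the nodes, and uniqueness of interpolation. -/

section NodeMonomials

variable {ι : Type*} [LinearOrder ι]

instance Node.finite [Finite ι] : Finite (Node ι) := by
  -- The number records the kind of node; unused slots repeat an index.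
  let f : Node ι → ℕ × ι × ι × ι × ι := fun a => match a with
    | centroid i j k l _ => (0, i, j, k, l)
    | triangle i j k _ => (1, i, j, k, k)
    | outer i j _ => (2, i, j, j, j)
    | midpoint i j _ => (3, i, j, j, j)
    | vertex i => (4, i, i, i, i)
  have hf : ∀ a, f a ∈ Set.Iic 4 ×ˢ (Set.univ : Set (ι × ι × ι × ι)) := by
    intro a
    cases a <;> simp [f]
  refine Finite.of_injective (fun a => (⟨f a,
      hf a⟩ : ↥(Set.Iic 4 ×ˢ (Set.univ : Set (ι × ι × ι × ι))))) ?_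
  intro a b h
  cases a <;> cases b <;> simp_all [f]

/-- The monomial of degree four that corresponds to a node. -/
def Node.monomial {A : Type*} [CommSemiring A] (x : ι → A) : Node ι → A
  | centroid i j k l _ => x i * x j * x k * x l
  | triangle i j k _ => x i ^ 2 * x j * x k
  | outer i j _ => x i ^ 3 * x j
  | midpoint i j _ => x i ^ 2 * x j ^ 2
  | vertex i => x i ^ 4

/-- Each of the eight patterns of ties in `i ≤ j ≤ k ≤ l` determines the kind of node. -/
theorem Node.exists_monomial_eq_of_sorted {A : Type*} [CommSemiring A] (x : ι → A) {i j k l : ι}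
    (hij : i ≤ j) (hjk : j ≤ k) (hkl : k ≤ l) :
    ∃ a : Node ι, a.monomial x = x i * (x j * (x k * x l)) := by
  rcases hij.eq_or_lt with rfl | hij <;> rcases hjk.eq_or_lt with rfl | hjk <;>
    rcases hkl.eq_or_lt with rfl | hkl
  · exact ⟨vertex i, by rw [monomial]; ring⟩
  · exact ⟨outer i l hkl.ne, by rw [monomial]; ring⟩
  · exact ⟨midpoint i k hjk, by rw [monomial]; ring⟩
  · exact ⟨triangle i k l ⟨hjk.ne, (hjk.trans hkl).ne, hkl⟩, by rw [monomial]; ring⟩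
  · exact ⟨outer j i hij.ne', by rw [monomial]; ring⟩
  · exact ⟨triangle j i l ⟨hij.ne', hkl.ne, hij.trans hkl⟩, by rw [monomial]; ring⟩
  · exact ⟨triangle k i j ⟨(hij.trans hjk).ne', hjk.ne', hij⟩, by rw [monomial]; ring⟩
  · exact ⟨centroid i j k l ⟨hij, hjk, hkl⟩, by rw [monomial]; ring⟩

theorem Node.exists_monomial_eq {A : Type*} [CommSemiring A] (x : ι → A) {m : Multiset ι}
    (hm : m.card = 4) : ∃ a : Node ι, a.monomial x = (m.map x).prod := by
  have hs := m.pairwise_sort (· ≤ ·)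
  have hl : (m.sort (· ≤ ·)).length = 4 := by rw [Multiset.length_sort, hm]
  have he := m.sort_eq (· ≤ ·)
  obtain ⟨i, j, k, l, hijkl⟩ := List.length_eq_four.1 hl
  rw [hijkl] at hs he
  simp only [List.pairwise_cons] at hs
  obtain ⟨a, ha⟩ := exists_monomial_eq_of_sorted x (hs.1 j (by simp)) (hs.2.1 k (by simp))
    (hs.2.2.1 l (by simp))
  exact ⟨a, by simp [ha, ← he]⟩

theorem span_pow_four_le_span_range_monomial {A : Type*} [CommRing A] [Algebra ℝ A] (x : ι → A) :
    Submodule.span ℝ (Set.range x) ^ 4 ≤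
      Submodule.span ℝ (Set.range fun a : Node ι => a.monomial x) := by
  rw [Submodule.span_pow]
  refine Submodule.span_mono fun y hy => ?_
  obtain ⟨f, rfl⟩ := Set.mem_pow.1 hy
  choose g hg using fun n => (f n).2
  obtain ⟨a, ha⟩ := Node.exists_monomial_eq x (m := (List.ofFn g : Multiset ι)) (by simp)
  refine ⟨a, ?_⟩
  simp only [ha, Multiset.map_coe, Multiset.prod_coe, List.map_ofFn]
  congr 2
  funext n
  exact hg n

/-- A polynomial function of degree at most four is determined by its values at points indexed by
the nodes that admit Lagrange polynomials. -/
theorem IsPolynomialFunction.eq_zero_of_apply_node [Finite ι] {σ : Type*} {x : ι → (σ → ℝ) → ℝ}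
    (h₁ : 1 ∈ Submodule.span ℝ (Set.range x))
    (hx : ∀ i : σ, (fun y => y i) ∈ Submodule.span ℝ (Set.range x))
    {P : Node ι → σ → ℝ} {l : Node ι → (σ → ℝ) → ℝ} (hl : ∀ a, IsPolynomialFunction 4 (l a))
    (hself : ∀ a, l a (P a) = 1) (hne : ∀ a b, a ≠ b → l a (P b) = 0)
    {f : (σ → ℝ) → ℝ} (hf : IsPolynomialFunction 4 f) (hfP : ∀ a, f (P a) = 0) : f = 0 := by
  classical
  have := Fintype.ofFinite (Node ι)
  let T := Fintype.linearCombination ℝ fun a : Node ι => a.monomial x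
  have hT : ∀ g, IsPolynomialFunction 4 g → ∃ c, T c = g := by
    intro g hg
    have h := span_pow_four_le_span_range_monomial x (hg.mem_pow h₁ hx)
    rwa [← Fintype.range_linearCombination] at h
  let E : ((σ → ℝ) → ℝ) →ₗ[ℝ] Node ι → ℝ := LinearMap.funLeft ℝ ℝ P
  -- Domain and codomain are both `Node ι → ℝ`, so surjectivity gives injectivity without counting
  -- nodes or proving the monomials independent.
  have hsurj : Function.Surjective (E ∘ₗ T) := by
    intro v
    choose c hc using fun a => hT (l a) (hl a)
    refine ⟨∑ a, v a • c a, ?_⟩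
    simp only [map_sum, map_smul, LinearMap.comp_apply, hc]
    funext b
    rw [Finset.sum_apply, Finset.sum_eq_single b]
    · simp [E, LinearMap.funLeft_apply, hself]
    · intro a _ hab
      simp [E, LinearMap.funLeft_apply, hne a b hab]
    · simp
  have hinj := LinearMap.injective_iff_surjective.2 hsurj
  obtain ⟨c, rfl⟩ := hT f hf
  have : c = 0 := hinj (by
    rw [map_zero]
    funext a
    exact hfP a)
  rw [this, map_zero]

end NodeMonomials

/-! ### The interpolation set of degree four -/

section NodeDegrees

variable {ι : Type*} [LinearOrder ι] [Fintype ι] {σ : Type*}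

theorem IsPolynomialFunction.nodeValue (r q : ℝ) {y : ι → (σ → ℝ) → ℝ}
    (hy : ∀ i, IsPolynomialFunction 1 (y i)) (a : Node ι) :
    IsPolynomialFunction 4 fun x => a.value r q fun i => y i x := by
  have hc := const (σ := σ)
  have hu : IsPolynomialFunction 2 fun x => powerSum (fun i => y i x) Finset.univ 2 :=
    sum fun i _ => (hy i).pow 2
  have hv : IsPolynomialFunction 3 fun x => powerSum (fun i => y i x) Finset.univ 3 :=
    sum fun i _ => (hy i).pow 3
  have htail : ∀ (l m n : ℝ) (i j : ι), IsPolynomialFunction 2 fun x =>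
      edgeTail l m n (y i x) (y j x) (powerSum (fun i => y i x) Finset.univ 2) := by
    intro l m n i j
    have ha := hy i
    have hb := hy j
    have hs := ((hc 1 1).sub ha).sub hb
    have hw := (hu.sub (ha.pow 2)).sub (hb.pow 2)
    exact ((((ha.add hb).mul hs).const_mul l).add (hw.const_mul m)).add
      ((((hs.pow 2).sub hw).div_const 2).const_mul n)
  cases a with
  | centroid i j k l h => exact (((((hc 0 256).mul (hy i)).mul (hy j)).mul (hy k)).mul (hy l))
  | triangle i j k h =>
    exact (((hy i).mul (hy j)).mul (hy k)).mul ((((hy i).const_mul _).add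
      (((hy j).add (hy k)).const_mul _)).sub (hc 1 _))
  | outer i j h =>
    have ha := hy i
    have hb := hy j
    have hs := ((hc 1 1).sub ha).sub hb
    refine add (((ha.mul hb).mul ((((ha.sub hb).pow 2).const_mul _).add (htail _ _ _ i j))))
      (const_mul ?_ q)
    exact ((ha.mul hb).mul (hb.sub ha)).mul (((ha.add hb).const_mul _).sub (hs.const_mul _))
  | midpoint i j h =>
    have ha := hy i
    have hb := hy j
    exact (ha.mul hb).mul (((((ha.pow 2).add (hb.pow 2)).const_mul _).add
      ((ha.mul hb).const_mul _)).add (htail _ _ _ i j))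
  | vertex i =>
    have ha := hy i
    have hs := (hc 1 1).sub ha
    have hw := hu.sub (ha.pow 2)
    have hz := hv.sub (ha.pow 3)
    exact ha.mul ((((((ha.pow 3).sub (((ha.pow 2).const_mul 6).mul hs)).add
      ((ha.const_mul 6).mul hw)).add ((ha.mul (((hs.pow 2).sub hw).div_const 2)).const_mul _)).sub
      hz).sub (((hs.mul hw).sub hz).const_mul _) |>.sub
      (((((hs.pow 3).sub ((hs.const_mul 3).mul hw)).add (hz.const_mul 2)).div_const 6).const_mul _))

end NodeDegrees

section Simplex

variable {d : ℕ} {V : Fin (d + 1) → Fin d → ℝ}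

/-- The node of the simplex with vertices `V` that corresponds to `a`. -/
noncomputable def nodePoint (V : Fin (d + 1) → Fin d → ℝ) (a : Node (Fin (d + 1))) : Fin d → ℝ :=
  ∑ i, a.weight (Real.sqrt 5) (Real.sqrt (3 / 7)) i • V i

theorem coord_sum_smul (hV : AffineIndependent ℝ V) {w : Fin (d + 1) → ℝ} (hw : ∑ i, w i = 1)
    (i : Fin (d + 1)) : (vertexBasis V hV).coord i (∑ j, w j • V j) = w i := by
  have h := (vertexBasis V hV).coord_apply_combination_of_mem (Finset.mem_univ i) hw
  rwa [Finset.affineCombination_eq_linear_combination _ _ _ hw] at h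

theorem coord_nodePoint (hV : AffineIndependent ℝ V) (a : Node (Fin (d + 1))) :
    (fun i => (vertexBasis V hV).coord i (nodePoint V a)) =
      a.weight (Real.sqrt 5) (Real.sqrt (3 / 7)) := by
  funext i
  exact coord_sum_smul hV (by simpa [powerSum] using a.powerSum_weight_one) i

theorem nodePoint_centroid (V : Fin (d + 1) → Fin d → ℝ) {i j k l : Fin (d + 1)}
    (h : i < j ∧ j < k ∧ k < l) :
    nodePoint V (.centroid i j k l h) = (1 / 4 : ℝ) • (V i + V j + V k + V l) := by
  simp [nodePoint, Node.weight, add_smul, Finset.sum_add_distrib, Pi.single_apply, ite_smul]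

theorem nodePoint_triangle (V : Fin (d + 1) → Fin d → ℝ) {i j k : Fin (d + 1)}
    (h : i ≠ j ∧ i ≠ k ∧ j < k) : nodePoint V (.triangle i j k h) =
      ((4 + Real.sqrt 5) / 11) • V i + ((7 - Real.sqrt 5) / 22) • (V j + V k) := by
  simp [nodePoint, Node.weight, add_smul, Finset.sum_add_distrib, Pi.single_apply, ite_smul,
    add_assoc]

theorem nodePoint_outer (V : Fin (d + 1) → Fin d → ℝ) {i j : Fin (d + 1)} (h : i ≠ j) :
    nodePoint V (.outer i j h) =
      ((1 - Real.sqrt (3 / 7)) / 2) • V i + ((1 + Real.sqrt (3 / 7)) / 2) • V j := by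
  simp [nodePoint, Node.weight, add_smul, Finset.sum_add_distrib, Pi.single_apply, ite_smul]

theorem nodePoint_midpoint (V : Fin (d + 1) → Fin d → ℝ) {i j : Fin (d + 1)} (h : i < j) :
    nodePoint V (.midpoint i j h) = (1 / 2 : ℝ) • (V i + V j) := by
  simp [nodePoint, Node.weight, add_smul, Finset.sum_add_distrib, Pi.single_apply, ite_smul]

theorem nodePoint_vertex (V : Fin (d + 1) → Fin d → ℝ) (i : Fin (d + 1)) :
    nodePoint V (.vertex i) = V i := by
  simp [nodePoint, Node.weight, Pi.single_apply, ite_smul]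

theorem mem_degreeFourSet {x : Fin d → ℝ} :
    x ∈ degreeFourSet V ↔ ∃ a, nodePoint V a = x := by
  simp only [degreeFourSet, threeFaceCentroids, twoFacePoints, edgeOuterPoints, edgeMidpoints,
    Finset.mem_union, Finset.mem_image, Finset.mem_filter, Finset.mem_univ, true_and, Prod.exists]
  constructor
  · rintro ((((⟨i, j, k, l, h, rfl⟩ | ⟨i, j, k, h, rfl⟩) | ⟨i, j, h, rfl⟩) | ⟨i, j, h, rfl⟩) | ⟨i,
      rfl⟩)
    · exact ⟨_, nodePoint_centroid V h⟩
    · exact ⟨_, nodePoint_triangle V h⟩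
    · exact ⟨_, nodePoint_outer V h⟩
    · exact ⟨_, nodePoint_midpoint V h⟩
    · exact ⟨_, nodePoint_vertex V i⟩
  · rintro ⟨a, rfl⟩
    cases a with
    | centroid i j k l h =>
      exact Or.inl <| Or.inl <| Or.inl <| Or.inl ⟨i, j, k, l, h, (nodePoint_centroid V h).symm⟩
    | triangle i j k h =>
      exact Or.inl <| Or.inl <| Or.inl <| Or.inr ⟨i, j, k, h, (nodePoint_triangle V h).symm⟩
    | outer i j h => exact Or.inl <| Or.inl <| Or.inr ⟨i, j, h, (nodePoint_outer V h).symm⟩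
    | midpoint i j h => exact Or.inl <| Or.inr ⟨i, j, h, (nodePoint_midpoint V h).symm⟩
    | vertex i => exact Or.inr ⟨i, (nodePoint_vertex V i).symm⟩

/-- The Lagrange polynomial of a node as a function on the ambient space. -/
noncomputable def nodeFunction (hV : AffineIndependent ℝ V) (a : Node (Fin (d + 1)))
    (x : Fin d → ℝ) : ℝ :=
  a.value (Real.sqrt 5) (Real.sqrt (3 / 7)) fun i => (vertexBasis V hV).coord i x

theorem isPolynomialFunction_nodeFunction (hV : AffineIndependent ℝ V)
    (a : Node (Fin (d + 1))) : IsPolynomialFunction 4 (nodeFunction hV a) :=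
  .nodeValue _ _ (fun i => .affineMap ((vertexBasis V hV).coord i)) a

theorem sqrt_five_sq : Real.sqrt 5 ^ 2 = 5 := Real.sq_sqrt (by norm_num)

theorem sqrt_three_sevenths_sq : Real.sqrt (3 / 7) ^ 2 = 3 / 7 := Real.sq_sqrt (by norm_num)

theorem nodeFunction_self (hV : AffineIndependent ℝ V) (a : Node (Fin (d + 1))) :
    nodeFunction hV a (nodePoint V a) = 1 := by
  rw [nodeFunction, coord_nodePoint]
  exact a.value_weight_self sqrt_five_sq sqrt_three_sevenths_sq

theorem nodeFunction_of_ne (hV : AffineIndependent ℝ V) {a b : Node (Fin (d + 1))}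
    (hab : a ≠ b) : nodeFunction hV a (nodePoint V b) = 0 := by
  rw [nodeFunction, coord_nodePoint]
  exact Node.value_weight_of_ne sqrt_five_sq sqrt_three_sevenths_sq hab

theorem eq_zero_of_apply_nodePoint (hV : AffineIndependent ℝ V) {f : (Fin d → ℝ) → ℝ}
    (hf : IsPolynomialFunction 4 f) (h : ∀ a, f (nodePoint V a) = 0) : f = 0 := by
  refine hf.eq_zero_of_apply_node (x := fun i => (vertexBasis V hV).coord i) ?_ (fun j => ?_)
    (isPolynomialFunction_nodeFunction hV) (nodeFunction_self hV)
    (fun a b => nodeFunction_of_ne hV) h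
  · have h1 : (1 : (Fin d → ℝ) → ℝ) = ∑ i, ⇑((vertexBasis V hV).coord i) := by
      funext x
      rw [Finset.sum_apply]
      exact ((vertexBasis V hV).sum_coord_apply_eq_one x).symm
    rw [h1]
    exact Submodule.sum_mem _ fun i _ => Submodule.subset_span ⟨i, rfl⟩
  · have h1 : (fun x : Fin d → ℝ => x j) = ∑ i, V i j • ⇑((vertexBasis V hV).coord i) := by
      funext x
      have h2 := congrFun ((vertexBasis V hV).linear_combination_coord_eq_self x) j
      rw [← h2, Finset.sum_apply, Finset.sum_apply]
      exact Finset.sum_congr rfl fun i _ => mul_comm _ _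
    rw [h1]
    exact Submodule.sum_mem _ fun i _ => Submodule.smul_mem _ _ (Submodule.subset_span ⟨i, rfl⟩)

/-- The difference has degree at most 4 and vanishes at every node, hence is zero. -/
theorem IsLagrangePolynomial.eval_eq (hV : AffineIndependent ℝ V) {a : Node (Fin (d + 1))}
    {p : MvPolynomial (Fin d) ℝ}
    (hp : IsLagrangePolynomial 4 (degreeFourSet V) (nodePoint V a) p) (x : Fin d → ℝ) :
    MvPolynomial.eval x p = nodeFunction hV a x := by
  have hf : IsPolynomialFunction 4 fun x => MvPolynomial.eval x p - nodeFunction hV a x :=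
    .sub ⟨p, hp.1, fun _ => rfl⟩ (isPolynomialFunction_nodeFunction hV a)
  refine sub_eq_zero.1 (congrFun (eq_zero_of_apply_nodePoint hV hf fun b => ?_) x)
  rcases eq_or_ne a b with rfl | hab
  · rw [hp.2.1, nodeFunction_self, sub_self]
  · have hne : nodePoint V b ≠ nodePoint V a := by
      intro h
      have h1 := nodeFunction_of_ne hV hab
      rw [h, nodeFunction_self] at h1
      exact one_ne_zero h1
    rw [hp.2.2 _ (mem_degreeFourSet.2 ⟨b, rfl⟩) hne, nodeFunction_of_ne hV hab, sub_self]

theorem existsUnique_isLagrangePolynomial (hV : AffineIndependent ℝ V) {a : Fin d → ℝ}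
    (ha : a ∈ degreeFourSet V) :
    ∃! p : MvPolynomial (Fin d) ℝ, IsLagrangePolynomial 4 (degreeFourSet V) a p := by
  obtain ⟨a, rfl⟩ := mem_degreeFourSet.1 ha
  obtain ⟨p, hp, hpa⟩ := isPolynomialFunction_nodeFunction hV a
  refine ⟨p, ⟨hp, by rw [hpa, nodeFunction_self], fun b hb hne => ?_⟩, fun p' hp' => ?_⟩
  · obtain ⟨b, rfl⟩ := mem_degreeFourSet.1 hb
    rw [hpa]
    exact nodeFunction_of_ne hV fun h => hne (h ▸ rfl)
  · exact MvPolynomial.funext fun x => by rw [hpa, hp'.eval_eq hV]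

theorem coord_nonneg_of_mem_solidSimplex (hV : AffineIndependent ℝ V) {x : Fin d → ℝ}
    (hx : x ∈ solidSimplex V) (i : Fin (d + 1)) : 0 ≤ (vertexBasis V hV).coord i x := by
  have h := (vertexBasis V hV).convexHull_eq_nonneg_coord
  exact (h ▸ hx : x ∈ {x | ∀ i, 0 ≤ (vertexBasis V hV).coord i x}) i

end Simplex

/-! ### The sum of squares over the nodes -/

section PairSums

variable {ι : Type*}

theorem sum_sum_erase_comm [DecidableEq ι] (s : Finset ι) (g : ι → ι → ℝ) :
    ∑ i ∈ s, ∑ j ∈ s.erase i, g i j = ∑ i ∈ s, ∑ j ∈ s.erase i, g j i :=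
  Finset.sum_comm' fun i j => by
    simp only [Finset.mem_erase]
    tauto

theorem sum_sum_erase_eq_zero [DecidableEq ι] (s : Finset ι) {g : ι → ι → ℝ}
    (hg : ∀ i j, g j i = -g i j) : ∑ i ∈ s, ∑ j ∈ s.erase i, g i j = 0 := by
  have h := (sum_sum_erase_comm s g).trans (Finset.sum_congr rfl fun i _ =>
    Finset.sum_congr rfl fun j _ => hg i j)
  simp only [Finset.sum_neg_distrib] at h
  linarith

theorem two_mul_sum_sum_lt [LinearOrder ι] (s : Finset ι) {g : ι → ι → ℝ}
    (hg : ∀ i j, g j i = g i j) :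
    2 * ∑ i ∈ s, ∑ j ∈ s, (if i < j then g i j else 0) = ∑ i ∈ s, ∑ j ∈ s.erase i, g i j := by
  have h1 : ∑ i ∈ s, ∑ j ∈ s, (if i < j then g i j else 0) =
      ∑ i ∈ s, ∑ j ∈ s, (if j < i then g i j else 0) := by
    rw [Finset.sum_comm]
    simp only [hg]
  rw [two_mul]
  nth_rw 2 [h1]
  simp only [← Finset.sum_add_distrib]
  refine Finset.sum_congr rfl fun i _ => ?_
  rw [← Finset.filter_ne s i, Finset.sum_filter]
  refine Finset.sum_congr rfl fun j _ => ?_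
  rcases lt_trichotomy i j with h | rfl | h
  · simp [h, h.ne, h.not_gt]
  · simp
  · simp [h, h.ne', h.not_gt]

end PairSums

section NodeSums

variable {ι : Type*} [LinearOrder ι] [Fintype ι]

theorem triangleValue_swap (r a b c : ℝ) : triangleValue r a c b = triangleValue r a b c := by
  simp only [triangleValue]
  ring

theorem midpointValue_swap (r a b u : ℝ) : midpointValue r b a u = midpointValue r a b u := by
  simp only [midpointValue, edgeTail]
  ring

theorem outerEvenValue_swap (r a b u : ℝ) : outerEvenValue r b a u = outerEvenValue r a b u := by
  simp only [outerEvenValue, edgeTail]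
  ring

theorem outerOddValue_swap (r a b : ℝ) : outerOddValue r b a = -outerOddValue r a b := by
  simp only [outerOddValue]
  ring

theorem sum_triangle_nodes_eq (f : ι → ι → ι → ℝ) (hf : ∀ i j k, f i k j = f i j k) :
    ∑ t : ι × ι × ι with t.1 ≠ t.2.1 ∧ t.1 ≠ t.2.2 ∧ t.2.1 < t.2.2, f t.1 t.2.1 t.2.2 =
      (∑ i, ∑ j ∈ Finset.univ.erase i, ∑ k ∈ (Finset.univ.erase i).erase j, f i j k) / 2 := by
  rw [Finset.sum_filter, Fintype.sum_prod_type, Finset.sum_div]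
  refine Finset.sum_congr rfl fun i _ => ?_
  rw [← two_mul_sum_sum_lt _ (hf i), mul_div_cancel_left₀ _ two_ne_zero, Fintype.sum_prod_type,
    ← Finset.filter_ne, Finset.sum_filter]
  refine Finset.sum_congr rfl fun j _ => ?_
  rw [Finset.sum_filter]
  by_cases hij : i = j
  · simp [hij]
  · simp only [ne_eq, hij, not_false_eq_true, true_and, if_true]
    refine Finset.sum_congr rfl fun k _ => ?_
    rw [ite_and]

theorem sum_midpoint_nodes_eq (f : ι → ι → ℝ) (hf : ∀ i j, f j i = f i j) :
    ∑ t : ι × ι with t.1 < t.2, f t.1 t.2 = (∑ i, ∑ j ∈ Finset.univ.erase i, f i j) / 2 := by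
  rw [Finset.sum_filter, Fintype.sum_prod_type, ← two_mul_sum_sum_lt _ hf,
    mul_div_cancel_left₀ _ two_ne_zero]

/-- The cross term `2 q f g` is antisymmetric and cancels over ordered pairs, so `q` enters only
through its square. -/
theorem sum_outer_nodes_eq {q : ℝ} (hq : q ^ 2 = 3 / 7) (f g : ι → ι → ℝ)
    (hf : ∀ i j, f j i = f i j) (hg : ∀ i j, g j i = -g i j) :
    ∑ t : ι × ι with t.1 ≠ t.2, (f t.1 t.2 + q * g t.1 t.2) ^ 2 =
      ∑ i, ∑ j ∈ Finset.univ.erase i, (f i j ^ 2 + 3 / 7 * g i j ^ 2) := by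
  have h0 : ∑ i, ∑ j ∈ Finset.univ.erase i, 2 * q * (f i j * g i j) = 0 :=
    sum_sum_erase_eq_zero _ fun i j => by rw [hf, hg]; ring
  rw [← add_zero (∑ i, ∑ j ∈ Finset.univ.erase i, _), ← h0, Finset.sum_filter,
    Fintype.sum_prod_type]
  simp only [← Finset.sum_add_distrib]
  refine Finset.sum_congr rfl fun i _ => ?_
  rw [← Finset.filter_ne, Finset.sum_filter]
  refine Finset.sum_congr rfl fun j _ => ?_
  congr 1
  rw [← hq]
  ring

theorem sum_nodes_sq_le_one {r q : ℝ} (hr : r ^ 2 = 5) (h₁ : 2.236 ≤ r) (h₂ : r ≤ 2.2361)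
    (hq : q ^ 2 = 3 / 7) {x : ι → ℝ} (hx : ∀ i, 0 ≤ x i) (hx₁ : ∑ i, x i = 1)
    (hι₁ : 3 ≤ Fintype.card ι) (hι₂ : Fintype.card ι ≤ 8) :
    ∑ t : ι × ι × ι with t.1 ≠ t.2.1 ∧ t.1 ≠ t.2.2 ∧ t.2.1 < t.2.2,
        triangleValue r (x t.1) (x t.2.1) (x t.2.2) ^ 2 +
      ∑ t : ι × ι with t.1 ≠ t.2,
        outerValue r q (x t.1) (x t.2) (powerSum x Finset.univ 2) ^ 2 +
      ∑ t : ι × ι with t.1 < t.2,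
        midpointValue r (x t.1) (x t.2) (powerSum x Finset.univ 2) ^ 2 +
      ∑ i, vertexValue r (x i) (powerSum x Finset.univ 2) (powerSum x Finset.univ 3) ^ 2 ≤ 1 := by
  simp only [outerValue]
  rw [sum_triangle_nodes_eq (fun i j k => triangleValue r (x i) (x j) (x k) ^ 2)
      fun i j k => by rw [triangleValue_swap],
    sum_midpoint_nodes_eq (fun i j => midpointValue r (x i) (x j) (powerSum x Finset.univ 2) ^ 2)
      fun i j => by rw [midpointValue_swap],
    sum_outer_nodes_eq hq (fun i j => outerEvenValue r (x i) (x j) (powerSum x Finset.univ 2))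
      (fun i j => outerOddValue r (x i) (x j)) (fun i j => outerEvenValue_swap _ _ _ _)
      fun i j => outerOddValue_swap _ _ _]
  have h := sum_sq_eq_one_sub_residualForm hr x Finset.univ (by simpa [powerSum] using hx₁)
  have hn := residualForm_powerSum_nonneg hr h₁ h₂ hx Finset.univ hι₁ hι₂
  simp only [Finset.sum_add_distrib, ← Finset.sum_div] at h ⊢
  linarith

end NodeSums

/-! ### From labels back to the interpolation set, and the main theorem. -/

section MainTheorem

variable {d : ℕ} {V : Fin (d + 1) → Fin d → ℝ}

theorem sum_union_le {α : Type*} [DecidableEq α] {f : α → ℝ} (hf : ∀ a, 0 ≤ f a) (s t : Finset α) :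
    ∑ a ∈ s ∪ t, f a ≤ ∑ a ∈ s, f a + ∑ a ∈ t, f a := by
  rw [← Finset.sum_union_inter]
  exact le_add_of_nonneg_right (Finset.sum_nonneg fun a _ => hf a)

/-- An upper bound is all that is needed, so the four families of nodes need not be shown disjoint.
-/
theorem sum_degreeFourSet_sdiff_le {f : (Fin d → ℝ) → ℝ} (hf : ∀ a, 0 ≤ f a) :
    ∑ a ∈ degreeFourSet V \ threeFaceCentroids V, f a ≤
      ∑ a ∈ twoFacePoints V, f a + ∑ a ∈ edgeOuterPoints V, f a + ∑ a ∈ edgeMidpoints V, f a +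
        ∑ a ∈ Finset.univ.image V, f a := by
  have hsub : degreeFourSet V \ threeFaceCentroids V ⊆
      twoFacePoints V ∪ edgeOuterPoints V ∪ edgeMidpoints V ∪ Finset.univ.image V := by
    intro a
    simp only [degreeFourSet, Finset.mem_sdiff, Finset.mem_union]
    tauto
  have h1 := sum_union_le hf (twoFacePoints V ∪ edgeOuterPoints V ∪ edgeMidpoints V)
    (Finset.univ.image V)
  have h2 := sum_union_le hf (twoFacePoints V ∪ edgeOuterPoints V) (edgeMidpoints V)
  have h3 := sum_union_le hf (twoFacePoints V) (edgeOuterPoints V)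
  have h4 := Finset.sum_le_sum_of_subset_of_nonneg hsub fun a _ _ => hf a
  linarith

/-- The inequality of arithmetic and geometric means for each pair, then for the two pair sums. -/
theorem mul_four_le_one {a b c e : ℝ} (ha : 0 ≤ a) (hb : 0 ≤ b) (hc : 0 ≤ c) (he : 0 ≤ e)
    (h : a + b + c + e ≤ 1) : 256 * a * b * c * e ≤ 1 := by
  have h1 : 4 * (a * b) ≤ (a + b) ^ 2 := by nlinarith [sq_nonneg (a - b)]
  have h2 : 4 * (c * e) ≤ (c + e) ^ 2 := by nlinarith [sq_nonneg (c - e)]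
  have h3 : 4 * ((a + b) * (c + e)) ≤ 1 := by
    nlinarith [sq_nonneg (a + b - (c + e)), add_nonneg (add_nonneg ha hb) (add_nonneg hc he)]
  have h4 : 4 * (a * b) * (4 * (c * e)) ≤ (a + b) ^ 2 * (c + e) ^ 2 :=
    mul_le_mul h1 h2 (by positivity) (by positivity)
  have h5 : (4 * ((a + b) * (c + e))) ^ 2 ≤ 1 := pow_le_one₀ (by positivity) h3
  nlinarith

theorem abs_mul_four_coord_le_one (hV : AffineIndependent ℝ V) {i j k l : Fin (d + 1)}
    (h : i < j ∧ j < k ∧ k < l) {x : Fin d → ℝ} (hx : x ∈ solidSimplex V) :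
    |256 * (vertexBasis V hV).coord i x * (vertexBasis V hV).coord j x *
      (vertexBasis V hV).coord k x * (vertexBasis V hV).coord l x| ≤ 1 := by
  have h0 := coord_nonneg_of_mem_solidSimplex hV hx
  obtain ⟨h1, h2, h3⟩ := h
  have h4 := h1.trans h2
  have h5 := h2.trans h3
  have h6 := h1.trans h5
  have hi := h0 i
  have hj := h0 j
  have hk := h0 k
  have hl := h0 l
  rw [abs_of_nonneg (by positivity)]
  refine mul_four_le_one hi hj hk hl ?_
  have hs := Finset.sum_le_sum_of_subset_of_nonneg (Finset.subset_univ {i, j, k, l})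
    fun m _ _ => h0 m
  rw [(vertexBasis V hV).sum_coord_apply_eq_one x, Finset.sum_insert, Finset.sum_insert,
    Finset.sum_insert, Finset.sum_singleton] at hs
  · linarith
  · simp [h3.ne]
  · simp [h2.ne, h5.ne]
  · simp [h1.ne, h4.ne, h6.ne]

theorem mainTheorem2 (d : ℕ) (hd : 3 ≤ d) (V : Fin (d + 1) → Fin d → ℝ)
    (hV : AffineIndependent ℝ V) :
    (∀ a ∈ degreeFourSet V, ∃! p : MvPolynomial (Fin d) ℝ,
      IsLagrangePolynomial 4 (degreeFourSet V) a p) ∧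
    ∀ L : (Fin d → ℝ) → MvPolynomial (Fin d) ℝ,
      (∀ a ∈ degreeFourSet V, IsLagrangePolynomial 4 (degreeFourSet V) a (L a)) →
      (∀ i j k l : Fin (d + 1), i < j → j < k → k < l →
        (∀ x : Fin d → ℝ,
          MvPolynomial.eval x (L ((1 / 4 : ℝ) • (V i + V j + V k + V l))) =
            256 * (vertexBasis V hV).coord i x * (vertexBasis V hV).coord j x *
              (vertexBasis V hV).coord k x * (vertexBasis V hV).coord l x) ∧
        ∀ x ∈ solidSimplex V,
          |MvPolynomial.eval x (L ((1 / 4 : ℝ) • (V i + V j + V k + V l)))| ≤ 1) ∧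
      (d ≤ 7 → ∀ x ∈ solidSimplex V,
        ∑ a ∈ degreeFourSet V \ threeFaceCentroids V, (MvPolynomial.eval x (L a)) ^ 2 ≤ 1) := by
  refine ⟨fun a ha => existsUnique_isLagrangePolynomial hV ha, fun L hL => ?_⟩
  have heval : ∀ (a : Node (Fin (d + 1))) (x : Fin d → ℝ),
      MvPolynomial.eval x (L (nodePoint V a)) = nodeFunction hV a x := fun a x =>
    (hL _ (mem_degreeFourSet.2 ⟨a, rfl⟩)).eval_eq hV x
  refine ⟨fun i j k l hij hjk hkl => ?_, fun hd₇ x hx => ?_⟩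
  · have h : ∀ x : Fin d → ℝ,
        MvPolynomial.eval x (L ((1 / 4 : ℝ) • (V i + V j + V k + V l))) =
          256 * (vertexBasis V hV).coord i x * (vertexBasis V hV).coord j x *
            (vertexBasis V hV).coord k x * (vertexBasis V hV).coord l x := by
      intro x
      rw [← nodePoint_centroid V ⟨hij, hjk, hkl⟩, heval]
      rfl
    refine ⟨h, fun x hx => ?_⟩
    rw [h]
    exact abs_mul_four_coord_le_one hV ⟨hij, hjk, hkl⟩ hx
  · have hf : ∀ a, 0 ≤ MvPolynomial.eval x (L a) ^ 2 := fun a => sq_nonneg _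
    have h₁ : (2.236 : ℝ) ≤ Real.sqrt 5 := Real.le_sqrt_of_sq_le (by norm_num)
    have h₂ : Real.sqrt 5 ≤ (2.2361 : ℝ) := Real.sqrt_le_iff.2 (by norm_num)
    refine (sum_degreeFourSet_sdiff_le hf).trans (le_trans ?_
      (sum_nodes_sq_le_one sqrt_five_sq h₁ h₂ sqrt_three_sevenths_sq
        (coord_nonneg_of_mem_solidSimplex hV hx) ((vertexBasis V hV).sum_coord_apply_eq_one x)
        (by simp; omega) (by simp; omega)))
    -- Each family is an image of index tuples. Since squares are nonnegative, the sum over the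
    -- image is at most the sum over the tuples, with no appeal to injectivity.
    refine add_le_add (add_le_add (add_le_add ?_ ?_) ?_) ?_
    · refine (Finset.sum_image_le_of_nonneg fun a _ => hf a).trans
        (Finset.sum_le_sum fun t ht => ?_)
      rw [← nodePoint_triangle V (Finset.mem_filter.1 ht).2, heval]
      rfl
    · refine (Finset.sum_image_le_of_nonneg fun a _ => hf a).trans
        (Finset.sum_le_sum fun t ht => ?_)
      rw [← nodePoint_outer V (Finset.mem_filter.1 ht).2, heval]
      rfl
    · refine (Finset.sum_image_le_of_nonneg fun a _ => hf a).trans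
        (Finset.sum_le_sum fun t ht => ?_)
      rw [← nodePoint_midpoint V (Finset.mem_filter.1 ht).2, heval]
      rfl
    · refine (Finset.sum_image_le_of_nonneg fun a _ => hf a).trans
        (Finset.sum_le_sum fun i _ => ?_)
      rw [← nodePoint_vertex V i, heval]
      rfl

end MainTheorem
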